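/- **Setting.** Let $\mathcal J$ be a *pointed weak lattice*: a small connected category with finite $\mathrm{Hom}$-sets and a degree function $|\cdot|:\mathrm{Obj}\,\mathcal J\to\mathbb N$, with finitely many objects in each degree, such that every non-identity morphism strictly lowers degree and every object maps to an object of degree $0$, together with a two-sided ideal $\overline{\mathcal J}$ of "null" morphisms which contains $\mathrm{Id}_x$ iff $x$ is a zero object. Write $\widetilde{\mathbf J}(s,t)=\mathcal J(s,t)\setminus\overline{\mathcal J}(s,t)$. Let $\mathcal E$ be a pointed model category, with homotopy category $\mathrm{ho}(\mathcal E)$. A diagram is *pointed* if it sends null morphisms to zero maps. For $|x|>k$, $\mathcal J_x^k$ is the full subcategory of $\mathcal J$ on $x$ and on all $t$ with $\mathcal J(x,t)\neq\emptyset$ and $|t|\le k$, and $\partial\mathcal J_x^k$ is obtained from it by removing $x$. For a pointed diagram $Y$, the *reduced matching object* $\overline M^s_{j}$ is the pullback of the matching object $\lim_{s\to t,\ |t|\le j}Y(t)\to\prod_{\mathcal J(s,t),\,|t|\le j}Y(t)$ along the section $\prod_{\widetilde{\mathbf J}(s,t),\,|t|\le j}Y(t)\to\prod_{\mathcal J(s,t),\,|t|\le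 j}Y(t)$ which is zero on the factors indexed by null morphisms; $\overline{\mathrm{forget}}:\overline M^s_j\to\prod_{\widetilde{\mathbf J}(s,t),\,|t|\le j}Y(t)$ is the projection. $Y$ is *pointed Reedy fibrant* if each structure map $Y(s)\to\overline M^s_{|s|-1}$ is a fibration. **Data.** Let $|x|>k\ge 2$, and let $\widetilde Y_x^k:\mathcal J_x^k\to\mathrm{ho}(\mathcal E)$, $Y_x^{k-1}:\mathcal J_x^{k-1}\to\mathcal E$ and $Y_k:\partial\mathcal J_x^k\to\mathcal E$ be pointed functors, where $Y_k$ is pointed Reedy fibrant, $Y(x):=Y_x^{k-1}(x)$ is cofibrant, $Y_x^{k-1}$ and $Y_k$ agree on $\partial\mathcal J_x^{k-1}$, and both of them lift the corresponding restrictions of $\widetilde Y_x^k$. A *further extension* is a pointed functor $Y_x^k:\mathcal J_x^k\to\mathcal E$ which restricts to $Y_x^{k-1}$ and to $Y_k$ and lifts $\widetilde Y_x^k$. Put $$A=\prod_{|s|=k}\prod_{\widetilde{\mathbf J}(x,s)}Y(s),\quad M=\prod_{|s|=k}\prod_{\widetilde{\mathbf J}(x,s)}\overline M^s_{k-1},\quad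 B=\prod_{|s|=k}\prod_{\widetilde{\mathbf J}(x,s)}\prod_{|v|<k}\prod_{\widetilde{\mathbf J}(s,v)}Y(v),\quad C=\prod_{|t|<k}\prod_{\widetilde{\mathbf J}(x,t)}Y(t),$$ with $\alpha:A\to M$ the product of structure maps, $\beta:M\to B$ the product of the maps $\overline{\mathrm{forget}}$, and $\overline\Psi:C\to B$ the generalized diagonal (its component at $x\xrightarrow{g}s\xrightarrow{f}v$ is the projection to the factor of $fg$ if $fg$ is not null, and zero otherwise). Let $Q$ be the pullback of $C\xrightarrow{\overline\Psi}B\xleftarrow{\beta}M$, and let $\eta:Y(x)\to Q$ be the map given by $Y_x^{k-1}$, whose component in $C$ is $\sigma_{<k}=(Y_x^{k-1}(f))_f$. Let $\sigma:Y(x)\to A$ be given by any choice of representatives of the classes $\widetilde Y_x^k(g)$, $g\in\widetilde{\mathbf J}(x,s)$, $|s|=k$. **Total operation.** Factor $\overline\Psi$ in any way as a weak equivalence $\iota:C\to F^1$ followed by a fibration $\overline\Psi':F^1\to B$. Let $F^2=F^1\times_BM$, with projection $q:F^2\to F^1$ and induced map $\gamma:Q\to F^2$. The *total pointed higher homotopy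 operation* is the set of homotopy classes of maps $\theta:Y(x)\to F^2$ with $\overline\Psi' q\theta=\beta\alpha\sigma$ and $q\theta\sim\iota\sigma_{<k}$. It *vanishes* if it contains the class of $\gamma\eta$. **Separated operations.** Consider a factorization $M=F^{0,k}\to F^{0,k-1}\to\dots\to F^{0,1}=B$ of $\beta$ into $k-1$ maps such that all of them except possibly the first are fibrations, the first is a monomorphism, $\alpha$ is a fibration, and $M$ and $B$ are fibrant; put $F^{0,k+1}=A$, with the map $\alpha$ to $F^{0,k}$. Column $1$ of the associated grid is the pullback of this column along $F^{1,1}=F^1\to B$. For $2\le j\le k-1$, factor the induced map $Q\to F^{j-1,j}$ as a weak equivalence $\varphi^j:Q\to F^{j,j}$ followed by a fibration $q_j:F^{j,j}\to F^{j-1,j}$, and let column $j$ be the pullback along $q_j$ of the part of column $j-1$ above $F^{j-1,j}$. Write $\varphi^1:Q\to C\xrightarrow{\iota}F^1$ and $q_1=\overline\Psi'$; let $r_j:F^{j,j+1}\to F^{j,j}$ be the lowest vertical maps, $p_j:F^{j,j+1}\to F^{j-1,j+1}$ and $u_j:F^{j,k+1}\to F^{j-1,k+1}$ the horizontal maps,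 $\Phi^{j}:F^{j,k+1}\to F^{j,j+1}$ and $\beta_{j-1}:F^{j-1,k+1}\to F^{j-1,j+1}$ the vertical composites, and $\psi^j:Q\to F^{j,j+1}$ the induced maps. Let $\kappa_0=\sigma$. For $1\le j\le k-1$ and given $\kappa_{j-1}:Y(x)\to F^{j-1,k+1}$, the *separated operation of order $j+1$* is *defined* if $\Phi^{j-1}\kappa_{j-1}\sim q_j\varphi^j\eta$. It is the set of homotopy classes of maps $\theta:Y(x)\to F^{j,j+1}$ such that $r_j\theta\sim\varphi^j\eta$ and, if $j<k-1$, $p_j\theta=\beta_{j-1}\kappa_{j-1}$, respectively, if $j=k-1$, $q_{k-1}r_{k-1}\theta=\Phi^{k-2}\kappa_{k-2}$. It *vanishes* if it contains the class of $\psi^j\eta$. The sequence of separated operations *vanishes* if there are inductively chosen $\kappa_j$ with $u_j\kappa_j=\kappa_{j-1}$ and $\Phi^j\kappa_j\sim\psi^j\eta$ for $1\le j<k-1$, such that the operations of orders $2,\dots,k$ are each in turn defined and vanish. **Inductive grids.** A decomposition $D_s^{k}$ of $\overline{\mathrm{forget}}:\overline M^s_{k-1}\to\prod_{\widetilde{\mathbf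 J}(s,t),\,|t|<k}Y(t)$ into $k-1$ maps is constructed inductively for $k\ge2$. For $k=2$ it is the map itself. Given all $D^{k}_t$, form the grid as above for $s$ in place of $x$ with right column the product of the $D_t^k$ over $g\in\widetilde{\mathbf J}(s,t)$, $|t|=k$ (and with $A,M,B,C,Q$ formed at $s$). Its top row is a tower of $k$ maps $P=Q\times_MA\to F^{k-1,k+1}\to\dots\to F^{1,k+1}\to A$. The pullback of its right column (from $M$ down to $B$) along $\overline\Psi:C\to B$ is a tower $Q\to\dots\to C$ of $k-1$ maps; replace its first map $Q\to G$ by a factorization $N\to G'\to G$ of $N\to Q\to G$ as a weak equivalence followed by a fibration, where $N=\overline M^s_{k-1}\times_CQ$. The product of the two resulting towers of $k$ maps, precomposed with $\overline M^s_k\to P\times N$, is $D_s^{k+1}$. All factorizations are arbitrary. **Theorem.** For all data as above: * The total pointed operation separates into a sequence of $k-1$ pointed operations: for any choices in the inductive construction, the product of the towers $D_s^k$ over $g\in\widetilde{\mathbf J}(x,s)$, $|s|=k$, is a factorization $M\to\dots\to B$ of $\beta$ into $k-1$ maps with all the properties required of the right column of a grid. * For every right column with these properties, the second object from the top of column $1$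 is canonically isomorphic to $F^2$, compatibly with the maps to $F^1$ and $M$, and for all choices of factorizations the following are equivalent: 1. a further extension to $Y_x^k:\mathcal J_x^k\to\mathcal E$ exists; 2. the total pointed operation vanishes; 3. the associated sequence of $k-1$ separated pointed operations, of orders $2,\dots,k$, vanishes (so in particular each in turn is defined). -/

import Mathlib

open CategoryTheory CategoryTheory.Limits HomotopicalAlgebra

universe w v u v' u'

attribute [-instance] catToReflQuiver

set_option linter.unusedSectionVars false

namespace HigherOp

/-! ## Indexing categories -/

/-- A weak lattice: a small, connected, locally finite category graded by a degree
function, with finitely many objects in each degree, such that every non-identity morphism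
strictly lowers degree and every object maps to an object of degree zero.
(Such a category is a Reedy category in which every morphism is inverse.) -/
class WeakLattice (J : Type w) [SmallCategory J] where
  /-- the degree of an object -/
  deg : J → ℕ
  connected : IsConnected J
  finite_hom : ∀ a b : J, Finite (a ⟶ b)
  finite_deg : ∀ n : ℕ, {a : J | deg a = n}.Finite
  id_or_deg_lt : ∀ {a b : J} (f : a ⟶ b), (∃ h : a = b, f = eqToHom h) ∨ deg b < deg a
  exists_deg_zero : ∀ a : J, ∃ b : J, deg b = 0 ∧ Nonempty (a ⟶ b)


/-- A pointed indexing category: a two-sided ideal of "null" morphisms, containing an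
identity only when the object is a zero object.  The morphisms which are not null form
the complementary class of the partition. -/
class PointedIndexing (J : Type w) [SmallCategory J] where
  /-- the ideal of morphisms which have to be sent to zero maps -/
  null : ∀ {a b : J}, (a ⟶ b) → Prop
  null_id_iff : ∀ a : J, null (𝟙 a) ↔ IsZero a
  null_comp_left : ∀ {a b c : J} (f : a ⟶ b) (g : b ⟶ c), null f → null (f ≫ g)
  null_comp_right : ∀ {a b c : J} (f : a ⟶ b) (g : b ⟶ c), null g → null (f ≫ g)

/-- Abbreviation for the degree function of a weak lattice. -/
abbrev deg {J : Type w} [SmallCategory J] [WeakLattice J] (a : J) : ℕ := WeakLattice.deg a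

/-- Abbreviation for the ideal of null morphisms of a pointed indexing category. -/
abbrev Null {J : Type w} [SmallCategory J] [PointedIndexing J] {a b : J} (f : a ⟶ b) : Prop :=
  PointedIndexing.null f

section Index

variable {J : Type w} [SmallCategory J] [WeakLattice J]

/-- The objects of degree at most `k` which receive a morphism from `x`.  When `k < deg x`
the corresponding full subcategory does not contain `x`; it is the category `∂J_x^k`. -/
def bdry (x : J) (k : ℕ) : ObjectProperty J := fun t => Nonempty (x ⟶ t) ∧ deg t ≤ k

/-- The object `x` together with the objects of degree at most `k` which receive a morphism
from `x`.  The corresponding full subcategory is the category `J_x^k`. -/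
def under (x : J) (k : ℕ) : ObjectProperty J := fun t => t = x ∨ bdry x k t

lemma bdry_le_under (x : J) (k : ℕ) : bdry x k ≤ under x k := fun _ h => Or.inr h

lemma bdry_mono (x : J) {k l : ℕ} (h : k ≤ l) : bdry x k ≤ bdry x l :=
  fun _ ht => ⟨ht.1, ht.2.trans h⟩

lemma under_mono (x : J) {k l : ℕ} (h : k ≤ l) : under x k ≤ under x l :=
  fun _ ht => ht.imp id (fun h' => bdry_mono x h _ h')

variable (P : ObjectProperty J) (s : J)

/-- Morphisms of `J` from `s` to objects satisfying `P`, with commutative triangles. -/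
abbrev Out : Type w := StructuredArrow s P.ι

/-- Morphisms from `s` to objects of degree less than `m`. -/
abbrev degLT (m : ℕ) : ObjectProperty (Out P s) := fun a => deg a.right.obj < m

/-- The comma category of morphisms from `s` to objects of degree less than `m`
(satisfying `P`). -/
abbrev Comma (m : ℕ) : Type w := (degLT P s m).FullSubcategory

lemma finite_comma_obj (m : ℕ) : Finite (Comma P s m) := by
  have hfin : Finite {t : J | WeakLattice.deg t < m} := by
    have : {t : J | WeakLattice.deg t < m}
        = ⋃ i ∈ Finset.range m, {t : J | WeakLattice.deg t = i} := by
      ext t; simp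
    rw [this]
    exact Set.Finite.biUnion (Finset.finite_toSet _) (fun i _ => WeakLattice.finite_deg i)
  have : ∀ t : J, Finite (s ⟶ t) := fun t => WeakLattice.finite_hom s t
  let φ : Comma P s m → Σ t : {t : J | WeakLattice.deg t < m}, (s ⟶ t.1) :=
    fun a => ⟨⟨a.obj.right.obj, a.property⟩, a.obj.hom⟩
  refine Finite.of_injective φ ?_
  rintro ⟨⟨⟨⟨⟩⟩, ⟨a, ha⟩, f⟩, hf⟩ ⟨⟨⟨⟨⟩⟩, ⟨b, hb⟩, g⟩, hg⟩ h
  have h1 : a = b := congrArg (fun z => z.1.1) h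
  subst h1
  have h2 : f = g := by
    have := (Sigma.mk.inj_iff.1 h).2
    exact eq_of_heq this
  subst h2
  rfl

noncomputable instance finCategory_comma (m : ℕ) : FinCategory (Comma P s m) where
  fintypeObj := @Fintype.ofFinite _ (finite_comma_obj P s m)
  fintypeHom a b := by
    have : Finite (a.obj.right.obj ⟶ b.obj.right.obj) := WeakLattice.finite_hom _ _
    refine @Fintype.ofFinite _ (Finite.of_injective
      (fun f : a ⟶ b => f.hom.right.hom) ?_)
    intro f g h
    ext
    exact h

variable [PointedIndexing J]

/-- The non-null morphisms from `s` to objects of degree less than `m`. -/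
abbrev LowIdx (m : ℕ) : Type w := {a : Out P s // deg a.right.obj < m ∧ ¬ Null a.hom}

/-- The non-null morphisms from `s` to objects of degree exactly `m`. -/
abbrev EqIdx (m : ℕ) : Type w := {a : Out P s // deg a.right.obj = m ∧ ¬ Null a.hom}

instance finite_lowIdx (m : ℕ) : Finite (LowIdx P s m) := by
  have := finite_comma_obj P s m
  exact Finite.of_injective (fun a : LowIdx P s m => (⟨a.1, a.2.1⟩ : Comma P s m))
    (fun a b h => Subtype.ext (congrArg (fun z => z.obj) h))

instance finite_eqIdx (m : ℕ) : Finite (EqIdx P s m) := by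
  have := finite_comma_obj P s (m + 1)
  refine Finite.of_injective
    (fun a : EqIdx P s m => (⟨a.1, ?_⟩ : Comma P s (m + 1)))
    (fun a b h => Subtype.ext (congrArg (fun z => z.obj) h))
  have := a.2.1
  show deg a.1.right.obj < m + 1
  omega

end Index

/-! ## Pointed diagrams and reduced matching objects -/

section Diagrams

variable {J : Type w} [SmallCategory J] [WeakLattice J] [PointedIndexing J]
variable {E : Type u} [Category.{v} E] [HasZeroMorphisms E]

/-- A diagram on a full subcategory of `J` is pointed if it sends null morphisms to `0`. -/
def IsPointed {P : ObjectProperty J} (Y : P.FullSubcategory ⥤ E) : Prop :=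
  ∀ {a b : P.FullSubcategory} (f : a ⟶ b), Null f.hom → Y.map f = 0

/-- Pointedness of a diagram in a category (such as a homotopy category) for which no zero
morphisms have been fixed: null morphisms go to maps factoring through a zero object. -/
def IsPointedHo {H : Type u'} [Category.{v'} H] {P : ObjectProperty J}
    (Y : P.FullSubcategory ⥤ H) : Prop :=
  ∀ {a b : P.FullSubcategory} (f : a ⟶ b), Null f.hom →
    ∃ (Z : H) (_ : IsZero Z) (p : Y.obj a ⟶ Z) (q : Z ⟶ Y.obj b), Y.map f = p ≫ q

variable [HasFiniteLimits E] {P : ObjectProperty J} (Y : P.FullSubcategory ⥤ E) (s : J)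

/-- The diagram `Ŷ (f : s ⟶ t) = Y t` on the comma category. -/
abbrev commaDiagram (m : ℕ) : Comma P s m ⥤ E :=
  (degLT P s m).ι ⋙ StructuredArrow.proj s P.ι ⋙ Y

/-- The (unreduced) matching object: the limit of `Y t` over all morphisms `s ⟶ t` with
`deg t < m`. -/
noncomputable abbrev matching (m : ℕ) : E := limit (commaDiagram Y s m)

/-- The product of `Y t` over all morphisms `s ⟶ t` with `deg t < m`. -/
noncomputable abbrev fullProd (m : ℕ) : E := ∏ᶜ fun a : Comma P s m => Y.obj a.obj.right

instance (m : ℕ) : HasProduct fun a : Comma P s m => Y.obj a.obj.right :=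
  have := finite_comma_obj P s m
  inferInstance

/-- The inclusion of the matching object into the product. -/
noncomputable def forgetFull (m : ℕ) : matching Y s m ⟶ fullProd Y s m :=
  Pi.lift fun a => limit.π (commaDiagram Y s m) a

lemma forgetFull_π (m : ℕ) (a : Comma P s m) :
    forgetFull Y s m ≫ Pi.π (fun a : Comma P s m => Y.obj a.obj.right) a =
      limit.π (commaDiagram Y s m) a :=
  Pi.lift_π _ _

/-- The product of `Y t` over the non-null morphisms `s ⟶ t` with `deg t < m`. -/
noncomputable abbrev lowProd (m : ℕ) : E := ∏ᶜ fun a : LowIdx P s m => Y.obj a.1.right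

open Classical in
/-- The section `Θ` of the projection, zero on the factors indexed by null morphisms. -/
noncomputable def theta (m : ℕ) : lowProd Y s m ⟶ fullProd Y s m :=
  Pi.lift fun a =>
    if h : Null a.obj.hom then 0
    else Pi.π (fun b : LowIdx P s m => Y.obj b.1.right) ⟨a.obj, a.property, h⟩

lemma theta_π_of_null (m : ℕ) (a : Comma P s m) (h : Null a.obj.hom) :
    theta Y s m ≫ Pi.π (fun a : Comma P s m => Y.obj a.obj.right) a = 0 :=
  (Pi.lift_π _ _).trans (dif_pos h)

lemma theta_π_of_not_null (m : ℕ) (a : Comma P s m) (h : ¬ Null a.obj.hom) :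
    theta Y s m ≫ Pi.π (fun a : Comma P s m => Y.obj a.obj.right) a =
      Pi.π (fun b : LowIdx P s m => Y.obj b.1.right) ⟨a.obj, a.property, h⟩ :=
  (Pi.lift_π _ _).trans (dif_neg h)

/-- The reduced matching object, using the morphisms `s ⟶ t` with `deg t < m`. -/
noncomputable abbrev rMatching (m : ℕ) : E := pullback (theta Y s m) (forgetFull Y s m)

/-- The reduced forgetful map from the reduced matching object to the product over
non-null morphisms. -/
noncomputable abbrev rForget (m : ℕ) : rMatching Y s m ⟶ lowProd Y s m :=
  pullback.fst (theta Y s m) (forgetFull Y s m)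

variable {Y s}

variable (Y s) in
/-- A pointed cone with vertex `X` over the morphisms `s ⟶ t` with `deg t < m`: compatible
maps `X ⟶ Y t`, which are zero for null morphisms. -/
structure PtCone (m : ℕ) (X : E) where
  /-- the component of the cone at `a : s ⟶ t` -/
  leg : ∀ a : Out P s, deg a.right.obj < m → (X ⟶ Y.obj a.right)
  natural : ∀ {a b : Out P s} (f : a ⟶ b) (ha : deg a.right.obj < m)
    (hb : deg b.right.obj < m), leg a ha ≫ Y.map f.right = leg b hb
  leg_null : ∀ (a : Out P s) (ha : deg a.right.obj < m), Null a.hom → leg a ha = 0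

namespace PtCone

variable {m : ℕ} {X : E}

/-- The map to the product over non-null morphisms given by a pointed cone. -/
noncomputable def toLow (c : PtCone Y s m X) : X ⟶ lowProd Y s m :=
  Pi.lift fun a => c.leg a.1 a.2.1

lemma toLow_π (c : PtCone Y s m X) (a : LowIdx P s m) :
    c.toLow ≫ Pi.π (fun a : LowIdx P s m => Y.obj a.1.right) a = c.leg a.1 a.2.1 :=
  Pi.lift_π _ _

/-- The map to the matching object given by a pointed cone. -/
noncomputable def toMatching (c : PtCone Y s m X) : X ⟶ matching Y s m :=
  limit.lift (commaDiagram Y s m)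
    { pt := X
      π :=
        { app := fun a => c.leg a.obj a.property
          naturality := fun a b f => by
            have := c.natural f.hom a.property b.property
            exact (Category.id_comp _).trans this.symm } }

lemma toMatching_π (c : PtCone Y s m X) (a : Comma P s m) :
    c.toMatching ≫ limit.π (commaDiagram Y s m) a = c.leg a.obj a.property :=
  limit.lift_π _ _

lemma toLow_theta (c : PtCone Y s m X) :
    c.toLow ≫ theta Y s m = c.toMatching ≫ forgetFull Y s m := by
  refine Pi.hom_ext _ _ fun a => ?_
  have h2 : (c.toMatching ≫ forgetFull Y s m) ≫
      Pi.π (fun a : Comma P s m => Y.obj a.obj.right) a = c.leg a.obj a.property :=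
    (Category.assoc _ _ _).trans
      ((congrArg (fun z => c.toMatching ≫ z) (forgetFull_π Y s m a)).trans (c.toMatching_π a))
  rw [h2]
  by_cases h : Null a.obj.hom
  · rw [Category.assoc, theta_π_of_null _ _ _ _ h, comp_zero, c.leg_null a.obj a.property h]
  · rw [Category.assoc, theta_π_of_not_null _ _ _ _ h, toLow_π]

/-- The map to the reduced matching object given by a pointed cone. -/
noncomputable def toRMatching (c : PtCone Y s m X) : X ⟶ rMatching Y s m :=
  pullback.lift c.toLow c.toMatching c.toLow_theta

lemma toRMatching_rForget (c : PtCone Y s m X) : c.toRMatching ≫ rForget Y s m = c.toLow :=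
  pullback.lift_fst _ _ _

/-- Restriction of a pointed cone to lower degrees. -/
def restrict (c : PtCone Y s m X) {l : ℕ} (h : l ≤ m) : PtCone Y s l X where
  leg a ha := c.leg a (ha.trans_le h)
  natural f _ _ := c.natural f _ _
  leg_null a _ hn := c.leg_null a _ hn

/-- The cone from a pointed cone, along a morphism out of `s`. -/
def along (c : PtCone Y s m X) (g : Out P s) : PtCone Y g.right.obj m X where
  leg a ha := c.leg (StructuredArrow.mk (Y := a.right) (g.hom ≫ a.hom)) ha
  natural {a b} f ha hb :=
    c.natural (a := StructuredArrow.mk (Y := a.right) (g.hom ≫ a.hom))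
      (b := StructuredArrow.mk (Y := b.right) (g.hom ≫ b.hom))
      (StructuredArrow.homMk f.right (by simp [← StructuredArrow.w f])) ha hb
  leg_null a ha hn := c.leg_null _ ha (PointedIndexing.null_comp_right _ _ hn)

end PtCone

variable (Y s) in
/-- The universal pointed cone, with vertex the reduced matching object. -/
noncomputable def univCone (m : ℕ) : PtCone Y s m (rMatching Y s m) where
  leg a ha := pullback.snd (theta Y s m) (forgetFull Y s m) ≫
    limit.π (commaDiagram Y s m) ⟨a, ha⟩
  natural {a b} f ha hb :=
    (Category.assoc _ _ _).trans (congrArg (fun z => pullback.snd _ _ ≫ z)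
      (limit.w (commaDiagram Y s m) (j := ⟨a, ha⟩) (j' := ⟨b, hb⟩) (ObjectProperty.homMk f)))
  leg_null a ha hn := by
    rw [← forgetFull_π, ← Category.assoc, ← pullback.condition, Category.assoc,
      theta_π_of_null _ _ _ _ hn, comp_zero]

/-- For an object `t` of the diagram itself, the pointed cone with vertex `Y t`. -/
def objCone (hY : IsPointed Y) (t : P.FullSubcategory) (m : ℕ) :
    PtCone Y t.obj m (Y.obj t) where
  leg a _ := Y.map (ObjectProperty.homMk a.hom)
  natural {a b} f _ _ := by
    rw [← Y.map_comp]
    congr 1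
    ext
    exact StructuredArrow.w f
  leg_null a _ hn := hY _ hn

/-- The structure map from `Y t` to the reduced matching object at `t`, using morphisms
to objects of degree less than `m`. -/
noncomputable def structureMap (hY : IsPointed Y) (t : P.FullSubcategory) (m : ℕ) :
    Y.obj t ⟶ rMatching Y t.obj m :=
  (objCone hY t m).toRMatching

end Diagrams

/-! ## The basic pullback grid -/

section BasicGrid

variable {J : Type w} [SmallCategory J] [WeakLattice J] [PointedIndexing J]
variable {E : Type u} [Category.{v} E] [HasZeroMorphisms E] [HasFiniteLimits E]
variable {P : ObjectProperty J} (Y : P.FullSubcategory ⥤ E) (s : J)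

/-- The product of `Y t` over the non-null morphisms `s ⟶ t` with `deg t = k`. -/
noncomputable abbrev eqProd (k : ℕ) : E := ∏ᶜ fun g : EqIdx P s k => Y.obj g.1.right

/-- The product, over the non-null `g : s ⟶ t` with `deg t = k`, of the reduced matching
objects of `t` in degrees less than `k`. -/
noncomputable abbrev matchProd (k : ℕ) : E :=
  ∏ᶜ fun g : EqIdx P s k => rMatching Y g.1.right.obj k

/-- The product of `Y v` over the pairs of non-null morphisms `s ⟶ t ⟶ v` with `deg t = k`
and `deg v < k`. -/
noncomputable abbrev doubleProd (k : ℕ) : E :=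
  ∏ᶜ fun g : EqIdx P s k => lowProd Y g.1.right.obj k

/-- The product of the reduced forgetful maps. -/
noncomputable abbrev forgetProd (k : ℕ) : matchProd Y s k ⟶ doubleProd Y s k :=
  Limits.Pi.map fun g : EqIdx P s k => rForget Y g.1.right.obj k

open Classical in
/-- The generalized diagonal: its component at `s ⟶ t ⟶ v` is the projection to the factor
indexed by the composite if the composite is not null, and zero otherwise. -/
noncomputable def genDiag (k : ℕ) : lowProd Y s k ⟶ doubleProd Y s k :=
  Pi.lift fun g : EqIdx P s k => Pi.lift fun f : LowIdx P g.1.right.obj k =>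
    if h : Null (g.1.hom ≫ f.1.hom) then 0
    else Pi.π (fun b : LowIdx P s k => Y.obj b.1.right)
      ⟨StructuredArrow.mk (Y := f.1.right) (g.1.hom ≫ f.1.hom), f.2.1, h⟩

/-- The pullback of the product of matching objects along the generalized diagonal. -/
noncomputable abbrev objQ (k : ℕ) : E := pullback (genDiag Y s k) (forgetProd Y s k)

/-- The pullback of `objQ` along the reduced forgetful map at `s`. -/
noncomputable abbrev objN (k : ℕ) : E :=
  pullback (rForget Y s k) (pullback.fst (genDiag Y s k) (forgetProd Y s k))

variable {Y s}

/-- The product of the structure maps `Y t ⟶ rMatching Y t k` over the non-null morphisms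
`s ⟶ t` with `deg t = k`. -/
noncomputable abbrev structProd (hY : IsPointed Y) (s : J) (k : ℕ) :
    eqProd Y s k ⟶ matchProd Y s k :=
  Limits.Pi.map fun g : EqIdx P s k => structureMap hY g.1.right k

/-- The pullback of the product of the `Y t`, `deg t = k`, to `objQ`. -/
noncomputable abbrev objP (hY : IsPointed Y) (s : J) (k : ℕ) : E :=
  pullback (pullback.snd (genDiag Y s k) (forgetProd Y s k)) (structProd hY s k)

lemma genDiag_π_of_null (k : ℕ) (g : EqIdx P s k) (f : LowIdx P g.1.right.obj k)
    (h : Null (g.1.hom ≫ f.1.hom)) :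
    genDiag Y s k ≫ Pi.π (fun g : EqIdx P s k => lowProd Y g.1.right.obj k) g ≫
      Pi.π (fun f : LowIdx P g.1.right.obj k => Y.obj f.1.right) f = 0 := by
  rw [← Category.assoc, genDiag, Pi.lift_π, Pi.lift_π, dif_pos h]

lemma genDiag_π_of_not_null (k : ℕ) (g : EqIdx P s k) (f : LowIdx P g.1.right.obj k)
    (h : ¬ Null (g.1.hom ≫ f.1.hom)) :
    genDiag Y s k ≫ Pi.π (fun g : EqIdx P s k => lowProd Y g.1.right.obj k) g ≫
      Pi.π (fun f : LowIdx P g.1.right.obj k => Y.obj f.1.right) f =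
    Pi.π (fun b : LowIdx P s k => Y.obj b.1.right)
      ⟨StructuredArrow.mk (Y := f.1.right) (g.1.hom ≫ f.1.hom), f.2.1, h⟩ := by
  rw [← Category.assoc, genDiag, Pi.lift_π, Pi.lift_π, dif_neg h]

namespace PtCone

variable {X : E} {k : ℕ}

/-- The map to the product of matching objects induced by a cone in degrees less than `k`. -/
noncomputable def rho (c : PtCone Y s k X) : X ⟶ matchProd Y s k :=
  Pi.lift fun g : EqIdx P s k => (c.along g.1).toRMatching

lemma toLow_genDiag (c : PtCone Y s k X) :
    c.toLow ≫ genDiag Y s k = c.rho ≫ forgetProd Y s k := by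
  refine Pi.hom_ext _ _ fun g => Pi.hom_ext _ _ fun f => ?_
  have h1 : (c.rho ≫ forgetProd Y s k) ≫
      Pi.π (fun g : EqIdx P s k => lowProd Y g.1.right.obj k) g =
      (c.along g.1).toLow := by
    rw [Category.assoc, Pi.map_π, ← Category.assoc, rho, Pi.lift_π, toRMatching_rForget]
  rw [h1, toLow_π, Category.assoc, Category.assoc]
  by_cases h : Null (g.1.hom ≫ f.1.hom)
  · rw [genDiag_π_of_null _ _ _ h, comp_zero]
    exact (c.leg_null (StructuredArrow.mk (Y := f.1.right) (g.1.hom ≫ f.1.hom)) f.2.1 h).symm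
  · rw [genDiag_π_of_not_null _ _ _ h, toLow_π]
    rfl

/-- The induced map to `objQ`. -/
noncomputable def eta (c : PtCone Y s k X) : X ⟶ objQ Y s k :=
  pullback.lift c.toLow c.rho c.toLow_genDiag

lemma eta_fst (c : PtCone Y s k X) :
    c.eta ≫ pullback.fst (genDiag Y s k) (forgetProd Y s k) = c.toLow :=
  pullback.lift_fst _ _ _

lemma eta_snd (c : PtCone Y s k X) :
    c.eta ≫ pullback.snd (genDiag Y s k) (forgetProd Y s k) = c.rho :=
  pullback.lift_snd _ _ _

/-- The induced map to `objN`. -/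
noncomputable def beta (c : PtCone Y s k X) : X ⟶ objN Y s k :=
  pullback.lift c.toRMatching c.eta (by rw [toRMatching_rForget, eta_fst])

/-- The induced map to the product of the objects of degree `k`. -/
noncomputable def top (c : PtCone Y s (k + 1) X) : X ⟶ eqProd Y s k :=
  Pi.lift fun g : EqIdx P s k => c.leg g.1 (by rw [g.2.1]; exact Nat.lt_succ_self k)

lemma toRMatching_unique {m : ℕ} (c : PtCone Y s m X) (f : X ⟶ rMatching Y s m)
    (h : ∀ (a : Out P s) (ha : deg a.right.obj < m),
      f ≫ (univCone Y s m).leg a ha = c.leg a ha) : f = c.toRMatching := by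
  have hsnd : f ≫ pullback.snd (theta Y s m) (forgetFull Y s m) =
      c.toRMatching ≫ pullback.snd (theta Y s m) (forgetFull Y s m) := by
    refine limit.hom_ext fun a => ?_
    have h1 := h a.obj a.property
    have h2 : c.toRMatching ≫ pullback.snd (theta Y s m) (forgetFull Y s m) = c.toMatching :=
      pullback.lift_snd _ _ _
    rw [h2, toMatching_π, ← h1, Category.assoc]
    rfl
  refine pullback.hom_ext ?_ hsnd
  refine Pi.hom_ext _ _ fun a => ?_
  have hcond : ∀ z : X ⟶ rMatching Y s m,
      (z ≫ rForget Y s m) ≫ Pi.π (fun b : LowIdx P s m => Y.obj b.1.right) a =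
        (z ≫ pullback.snd (theta Y s m) (forgetFull Y s m)) ≫
          limit.π (commaDiagram Y s m) ⟨a.1, a.2.1⟩ := by
    intro z
    have h0 := theta_π_of_not_null Y s m ⟨a.1, a.2.1⟩ a.2.2
    have h1 := congrArg (fun y => (z ≫ y) ≫
      Pi.π (fun a : Comma P s m => Y.obj a.obj.right) ⟨a.1, a.2.1⟩)
      (pullback.condition (f := theta Y s m) (g := forgetFull Y s m))
    have h2 : (z ≫ pullback.fst (theta Y s m) (forgetFull Y s m) ≫ theta Y s m) ≫
        Pi.π (fun a : Comma P s m => Y.obj a.obj.right) ⟨a.1, a.2.1⟩ =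
        (z ≫ rForget Y s m) ≫ Pi.π (fun b : LowIdx P s m => Y.obj b.1.right) a := by
      rw [← Category.assoc, Category.assoc, h0]
    have h3 : (z ≫ pullback.snd (theta Y s m) (forgetFull Y s m) ≫ forgetFull Y s m) ≫
        Pi.π (fun a : Comma P s m => Y.obj a.obj.right) ⟨a.1, a.2.1⟩ =
        (z ≫ pullback.snd (theta Y s m) (forgetFull Y s m)) ≫
          limit.π (commaDiagram Y s m) ⟨a.1, a.2.1⟩ := by
      rw [← Category.assoc, Category.assoc]
      exact congrArg _ (forgetFull_π Y s m ⟨a.1, a.2.1⟩)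
    exact h2.symm.trans (h1.trans h3)
  rw [hcond, hcond, hsnd]

lemma toRMatching_leg {m : ℕ} (c : PtCone Y s m X) (a : Out P s)
    (ha : deg a.right.obj < m) :
    c.toRMatching ≫ (univCone Y s m).leg a ha = c.leg a ha := by
  have h2 : c.toRMatching ≫ pullback.snd (theta Y s m) (forgetFull Y s m) = c.toMatching :=
    pullback.lift_snd _ _ _
  have := c.toMatching_π ⟨a, ha⟩
  rw [← h2, Category.assoc] at this
  exact this

lemma eta_structProd (hY : IsPointed Y) (c : PtCone Y s (k + 1) X) :
    (c.restrict (Nat.le_succ k)).eta ≫ pullback.snd (genDiag Y s k) (forgetProd Y s k)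
      = c.top ≫ structProd hY s k := by
  rw [eta_snd]
  refine Pi.hom_ext _ _ fun g => ?_
  have hg : deg g.1.right.obj < k + 1 := by rw [g.2.1]; exact Nat.lt_succ_self k
  rw [rho, Pi.lift_π, Category.assoc, Pi.map_π, ← Category.assoc, top, Pi.lift_π]
  refine (toRMatching_unique _ _ fun a ha => ?_).symm
  refine (Category.assoc _ _ _).trans ((congrArg (fun z => c.leg g.1 hg ≫ z)
    (toRMatching_leg (objCone hY g.1.right k) a ha)).trans ?_)
  exact c.natural (a := g.1)
    (b := StructuredArrow.mk (Y := a.right) (g.1.hom ≫ a.hom))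
    (StructuredArrow.homMk (ObjectProperty.homMk a.hom) rfl) hg
    (ha.trans (Nat.lt_succ_self k))

/-- The induced map to `objP`. -/
noncomputable def alpha (hY : IsPointed Y) (c : PtCone Y s (k + 1) X) : X ⟶ objP hY s k :=
  pullback.lift (c.restrict (Nat.le_succ k)).eta c.top (c.eta_structProd hY)

end PtCone

end BasicGrid

/-! ## Towers of composable maps -/

section Towers

variable {E : Type u} [Category.{v} E]

/-- A tower of `n + 1` composable maps from an object `T` (the top) to an object `B` (the
base).  The constructor `cons` adds a new map at the bottom. -/
inductive Tower : ℕ → E → E → Type (max u v)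
  | last {T B : E} (f : T ⟶ B) : Tower 0 T B
  | cons {n : ℕ} {T C B : E} (p : C ⟶ B) (t : Tower n T C) : Tower (n + 1) T B

namespace Tower

/-- The composite of all maps of a tower. -/
def comp {n : ℕ} {T B : E} (t : Tower n T B) : T ⟶ B :=
  match t with
  | last f => f
  | cons p t => t.comp ≫ p

/-- The first object above the base. -/
def fst {n : ℕ} {T B : E} (t : Tower n T B) : E :=
  match t with
  | last (T := T) _ => T
  | cons (C := C) _ _ => C

/-- The lowest map of a tower. -/
def low {n : ℕ} {T B : E} (t : Tower n T B) : t.fst ⟶ B :=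
  match t with
  | last f => f
  | cons p _ => p

/-- The composite of all maps of a tower, except for the lowest one. -/
def toFst {n : ℕ} {T B : E} (t : Tower n T B) : T ⟶ t.fst :=
  match t with
  | last _ => 𝟙 _
  | cons _ t => t.comp

/-- The tower obtained by omitting the lowest map. -/
def tail {n : ℕ} {T B : E} (t : Tower (n + 1) T B) : Tower n T t.fst :=
  match t with
  | cons _ t => t

lemma toFst_low {n : ℕ} {T B : E} (t : Tower n T B) : t.toFst ≫ t.low = t.comp := by
  cases t with
  | last f => exact Category.id_comp _
  | cons p t => rfl

lemma tail_comp_low {n : ℕ} {T B : E} (t : Tower (n + 1) T B) :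
    t.tail.comp ≫ t.low = t.comp := by
  cases t with
  | cons p t => rfl

/-- All maps of a tower, except for the top one, are fibrations. -/
def FibrationsBelowTop [CategoryWithFibrations E] {n : ℕ} {T B : E} (t : Tower n T B) : Prop :=
  match t with
  | last _ => True
  | cons p t => Fibration p ∧ t.FibrationsBelowTop

/-- The top map of a tower is a monomorphism. -/
def MonoTop {n : ℕ} {T B : E} (t : Tower n T B) : Prop :=
  match t with
  | last f => Mono f
  | cons _ t => t.MonoTop

/-- Precompose the top map. -/
def precomp {n : ℕ} {T T' B : E} (g : T' ⟶ T) (t : Tower n T B) : Tower n T' B :=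
  match t with
  | last f => last (g ≫ f)
  | cons p t => cons p (t.precomp g)

/-- Postcompose the lowest map. -/
def postcomp {n : ℕ} {T B B' : E} (t : Tower n T B) (h : B ⟶ B') : Tower n T B' :=
  match t with
  | last f => last (f ≫ h)
  | cons p t => cons (p ≫ h) t

lemma precomp_comp {n : ℕ} {T T' B : E} (g : T' ⟶ T) (t : Tower n T B) :
    (t.precomp g).comp = g ≫ t.comp := by
  induction t with
  | last f => rfl
  | cons p t ih => simp [precomp, comp, ih g]

lemma postcomp_comp {n : ℕ} {T B B' : E} (t : Tower n T B) (h : B ⟶ B') :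
    (t.postcomp h).comp = t.comp ≫ h := by
  cases t with
  | last f => rfl
  | cons p t => simp [postcomp, comp]

section Products

variable [HasFiniteProducts E]

/-- The levelwise binary product of two towers. -/
noncomputable def prod {n : ℕ} {T B T' B' : E} (t : Tower n T B) (t' : Tower n T' B') :
    Tower n (T ⨯ T') (B ⨯ B') :=
  match t, t' with
  | last f, last f' => last (Limits.prod.map f f')
  | cons p t, cons p' t' => cons (Limits.prod.map p p') (t.prod t')

lemma prod_comp {n : ℕ} {T B T' B' : E} (t : Tower n T B) (t' : Tower n T' B') :
    (t.prod t').comp = Limits.prod.map t.comp t'.comp := by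
  induction t generalizing T' B' with
  | last f => cases t' with
    | last f' => rfl
  | cons p t ih => cases t' with
    | cons p' t' => simp [prod, comp, ih]

/-- The levelwise product of a finite family of towers. -/
noncomputable def pi {I : Type w} [Finite I] {n : ℕ} {T B : I → E}
    (t : ∀ i, Tower n (T i) (B i)) : Tower n (∏ᶜ T) (∏ᶜ B) :=
  match n, t with
  | 0, t => last (Limits.Pi.map fun i => (t i).comp)
  | _ + 1, t => cons (Limits.Pi.map fun i => (t i).low) (pi fun i => (t i).tail)

lemma pi_comp {I : Type w} [Finite I] {n : ℕ} {T B : I → E}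
    (t : ∀ i, Tower n (T i) (B i)) : (pi t).comp = Limits.Pi.map fun i => (t i).comp := by
  induction n generalizing B with
  | zero => rfl
  | succ n ih =>
    have h := ih (fun i => (t i).tail)
    refine (congrArg (fun z => z ≫ Limits.Pi.map fun i => (t i).low) h).trans ?_
    refine Pi.hom_ext _ _ fun i => ?_
    rw [Category.assoc, Pi.map_π, ← Category.assoc, Pi.map_π, Pi.map_π, Category.assoc,
      tail_comp_low]

end Products

section Pullbacks

variable [HasPullbacks E]

/-- The top of the pullback of a tower along a map to its base. -/
noncomputable def pullTop {n : ℕ} {T B D : E} (t : Tower n T B) (q : D ⟶ B) : E :=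
  match t with
  | last f => pullback q f
  | cons p t => t.pullTop (pullback.snd q p)

/-- The pullback of a tower along a map to its base. -/
noncomputable def pull {n : ℕ} {T B D : E} (t : Tower n T B) (q : D ⟶ B) :
    Tower n (t.pullTop q) D :=
  match t with
  | last f => last (pullback.fst q f)
  | cons p t => cons (pullback.fst q p) (t.pull (pullback.snd q p))

/-- The projection from the top of the pullback of a tower. -/
noncomputable def pullProj {n : ℕ} {T B D : E} (t : Tower n T B) (q : D ⟶ B) :
    t.pullTop q ⟶ T :=
  match t with
  | last f => pullback.snd q f
  | cons p t => t.pullProj (pullback.snd q p)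

/-- The projection from the first object above the base of the pullback of a tower. -/
noncomputable def pullFstProj {n : ℕ} {T B D : E} (t : Tower n T B) (q : D ⟶ B) :
    (t.pull q).fst ⟶ t.fst :=
  match t with
  | last f => pullback.snd q f
  | cons p _ => pullback.snd q p

/-- The map to the top of the pullback of a tower given by the universal property. -/
noncomputable def pullLift {n : ℕ} {T B D X : E} (t : Tower n T B) (q : D ⟶ B)
    (a : X ⟶ D) (c : X ⟶ T) (h : a ≫ q = c ≫ t.comp) : X ⟶ t.pullTop q :=
  match t with
  | last f => pullback.lift a c h
  | cons p t => t.pullLift (pullback.snd q p)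
      (pullback.lift a (c ≫ t.comp) (h.trans (Category.assoc _ _ _).symm)) c
      (pullback.lift_snd _ _ _)

lemma pullLift_comp {n : ℕ} {T B D X : E} (t : Tower n T B) (q : D ⟶ B)
    (a : X ⟶ D) (c : X ⟶ T) (h : a ≫ q = c ≫ t.comp) :
    t.pullLift q a c h ≫ (t.pull q).comp = a := by
  induction t generalizing D with
  | last f => exact pullback.lift_fst _ _ _
  | cons p t ih =>
    refine (Category.assoc _ _ _).symm.trans ?_
    refine (congrArg (fun z => z ≫ pullback.fst q p) (ih _ _ c _)).trans ?_
    exact pullback.lift_fst _ _ _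

lemma pullLift_proj {n : ℕ} {T B D X : E} (t : Tower n T B) (q : D ⟶ B)
    (a : X ⟶ D) (c : X ⟶ T) (h : a ≫ q = c ≫ t.comp) :
    t.pullLift q a c h ≫ t.pullProj q = c := by
  induction t generalizing D with
  | last f => exact pullback.lift_snd _ _ _
  | cons p t ih => exact ih _ _ c _

end Pullbacks

end Tower

end Towers

/-! ## Columns and separation grids -/

section Columns

variable {E : Type u} [Category.{v} E] [ModelCategory E]

variable (E) in
/-- A choice, for every morphism, of a factorization as a weak equivalence followed by a
fibration. -/
abbrev Factorizations : Type (max u v) := ∀ ⦃X Y : E⦄ (f : X ⟶ Y),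
  MorphismProperty.MapFactorizationData (weakEquivalences E) (fibrations E) f

/-- Replace the top map `z : T ⟶ C` of a tower by `X ⟶ Z ⟶ C`, a factorization of `f ≫ z`
as a weak equivalence followed by a fibration, for a given `f : X ⟶ T`. -/
def Tower.capFac (φ : Factorizations E) {n : ℕ} {T B X : E} (f : X ⟶ T) (t : Tower n T B) :
    Tower (n + 1) X B :=
  match t with
  | last z => cons (φ (f ≫ z)).p (last (φ (f ≫ z)).i)
  | cons p t => cons p (t.capFac φ f)

lemma Tower.capFac_comp (φ : Factorizations E) {n : ℕ} {T B X : E} (f : X ⟶ T)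
    (t : Tower n T B) : (t.capFac φ f).comp = f ≫ t.comp := by
  induction t with
  | last z => exact (φ (f ≫ z)).fac
  | cons p t ih =>
    exact (congrArg (fun z => z ≫ p) (ih f)).trans (Category.assoc _ _ _)

/-- A column of a separation grid: a map `cap : top ⟶ mid`, a tower of `n + 1` maps from
`mid` to `base`, and a map to `mid` from a fixed object `Q`. -/
structure Column (Q : E) (n : ℕ) where
  /-- the object in the top row of the grid -/
  top : E
  /-- the object in the second row of the grid -/
  mid : E
  /-- the lowest object of the column -/
  base : E
  /-- the map between the top two rows -/
  cap : top ⟶ mid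
  /-- the rest of the column -/
  tower : Tower n mid base
  /-- the map from the fixed object `Q` -/
  γ : Q ⟶ mid

namespace Column

variable {Q : E} {n : ℕ}

/-- A factorization through some object of the given map from `Q` to the base of a column. -/
structure Step (c : Column Q n) where
  /-- the intermediate object, which will be the base of the next column -/
  obj : E
  /-- the first map of the factorization -/
  a : Q ⟶ obj
  /-- the second map of the factorization -/
  q : obj ⟶ c.base
  w : a ≫ q = c.γ ≫ c.tower.comp

/-- The factorization of the map from `Q` to the base of a column as a weak equivalence
followed by a fibration. -/
def step (c : Column Q n) (φ : Factorizations E) : c.Step where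
  obj := (φ (c.γ ≫ c.tower.comp)).Z
  a := (φ (c.γ ≫ c.tower.comp)).i
  q := (φ (c.γ ≫ c.tower.comp)).p
  w := (φ (c.γ ≫ c.tower.comp)).fac

/-- The pullback of a column along a map to its base. -/
noncomputable def next (c : Column Q n) (S : c.Step) : Column Q n where
  top := pullback (c.tower.pullProj S.q) c.cap
  mid := c.tower.pullTop S.q
  base := S.obj
  cap := pullback.fst _ _
  tower := c.tower.pull S.q
  γ := c.tower.pullLift S.q S.a c.γ S.w

/-- The projection between the top objects of adjacent columns. -/
noncomputable def u (c : Column Q n) (S : c.Step) : (c.next S).top ⟶ c.top :=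
  pullback.snd (c.tower.pullProj S.q) c.cap

/-- Omit the base of a column. -/
def drop (c : Column Q (n + 1)) : Column Q n where
  top := c.top
  mid := c.mid
  base := c.tower.fst
  cap := c.cap
  tower := c.tower.tail
  γ := c.γ

/-- Given compatible maps from `P` to `Q` and to the top of a column, the induced map from
`P` to the top of the next column. -/
noncomputable def liftTop (c : Column Q n) (S : c.Step) {P : E} (p : P ⟶ Q) (f : P ⟶ c.top)
    (h : f ≫ c.cap = p ≫ c.γ) : P ⟶ (c.next S).top :=
  pullback.lift (p ≫ c.tower.pullLift S.q S.a c.γ S.w) f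
    ((Category.assoc _ _ _).trans
      ((congrArg (fun z => p ≫ z) (c.tower.pullLift_proj S.q S.a c.γ S.w)).trans h.symm))

lemma liftTop_cap (c : Column Q n) (S : c.Step) {P : E} (p : P ⟶ Q) (f : P ⟶ c.top)
    (h : f ≫ c.cap = p ≫ c.γ) : c.liftTop S p f h ≫ (c.next S).cap = p ≫ (c.next S).γ :=
  pullback.lift_fst _ _ _

lemma liftTop_u (c : Column Q n) (S : c.Step) {P : E} (p : P ⟶ Q) (f : P ⟶ c.top)
    (h : f ≫ c.cap = p ≫ c.γ) : c.liftTop S p f h ≫ c.u S = f :=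
  pullback.lift_snd _ _ _

/-- The top row of the separation grid with right column `c`, a tower from `P` to the top
of `c`.  The next column is the pullback of `c` along the given step; then its base is
omitted, the map from `Q` to the new base is factored, and so on. -/
noncomputable def topRow (φ : ℕ → Factorizations E) {n : ℕ} (c : Column Q n) (S : c.Step)
    {P : E} (p : P ⟶ Q) (f : P ⟶ c.top) (h : f ≫ c.cap = p ≫ c.γ) : Tower (n + 1) P c.top :=
  match n, c, S, f, h with
  | 0, c, S, f, h => Tower.cons (c.u S) (Tower.last (c.liftTop S p f h))
  | n + 1, c, S, f, h =>
      Tower.cons (c.u S) (topRow φ (c.next S).drop ((c.next S).drop.step (φ n)) p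
        (c.liftTop S p f h) (c.liftTop_cap S p f h))

lemma topRow_comp (φ : ℕ → Factorizations E) {n : ℕ} (c : Column Q n) (S : c.Step)
    {P : E} (p : P ⟶ Q) (f : P ⟶ c.top) (h : f ≫ c.cap = p ≫ c.γ) :
    (c.topRow φ S p f h).comp = f := by
  induction n with
  | zero => exact c.liftTop_u S p f h
  | succ n ih =>
    refine (congrArg (fun z => z ≫ c.u S)
      (ih (c.next S).drop ((c.next S).drop.step (φ n)) (c.liftTop S p f h)
        (c.liftTop_cap S p f h))).trans ?_
    exact c.liftTop_u S p f h

end Column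

end Columns

section SeparationGrid

variable {J : Type w} [SmallCategory J] [WeakLattice J] [PointedIndexing J]
variable {E : Type u} [Category.{v} E] [ModelCategory E] [HasZeroMorphisms E]
variable {P : ObjectProperty J}

section

variable (Y : P.FullSubcategory ⥤ E) (s : J)

open Classical in
/-- The identification of the product over the non-null morphisms to objects of degree at
most `k` with the product of the factors of degree `k` and of those of lower degree. -/
noncomputable def joinProd (k : ℕ) : eqProd Y s k ⨯ lowProd Y s k ⟶ lowProd Y s (k + 1) :=
  Pi.lift fun a => if h : deg a.1.right.obj = k
    then prod.fst ≫ Pi.π (fun g : EqIdx P s k => Y.obj g.1.right) ⟨a.1, h, a.2.2⟩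
    else prod.snd ≫ Pi.π (fun g : LowIdx P s k => Y.obj g.1.right)
      ⟨a.1, lt_of_le_of_ne (Nat.le_of_lt_succ a.2.1) h, a.2.2⟩

end

variable {Y : P.FullSubcategory ⥤ E}

lemma lift_joinProd {s : J} {k : ℕ} {X : E} (c : PtCone Y s (k + 1) X) :
    prod.lift c.top (c.restrict (Nat.le_succ k)).toLow ≫ joinProd Y s k = c.toLow := by
  refine Pi.hom_ext _ _ fun a => ?_
  rw [Category.assoc, joinProd, Pi.lift_π, PtCone.toLow_π]
  split_ifs with h
  · rw [prod.lift_fst_assoc, PtCone.top, Pi.lift_π]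
  · rw [prod.lift_snd_assoc, PtCone.toLow_π]
    rfl

/-- The right column of the separation grid at `(s, k)` with a given tower. -/
noncomputable def rightColumn (hY : IsPointed Y) (s : J) (k : ℕ) {n : ℕ}
    (R : Tower n (matchProd Y s k) (doubleProd Y s k)) : Column (objQ Y s k) n where
  top := eqProd Y s k
  mid := matchProd Y s k
  base := doubleProd Y s k
  cap := structProd hY s k
  tower := R
  γ := pullback.snd (genDiag Y s k) (forgetProd Y s k)

/-- The first step of the separation grid at `(s, k)`: a factorization of the generalized
diagonal as a weak equivalence followed by a fibration. -/
noncomputable def firstStep (hY : IsPointed Y) (s : J) (k : ℕ) {n : ℕ}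
    (R : Tower n (matchProd Y s k) (doubleProd Y s k)) (hR : R.comp = forgetProd Y s k)
    (F : MorphismProperty.MapFactorizationData (weakEquivalences E) (fibrations E)
      (genDiag Y s k)) : (rightColumn hY s k R).Step where
  obj := F.Z
  a := pullback.fst (genDiag Y s k) (forgetProd Y s k) ≫ F.i
  q := F.p
  w := (Category.assoc _ _ _).trans
    ((congrArg (fun z => pullback.fst (genDiag Y s k) (forgetProd Y s k) ≫ z) F.fac).trans
      (pullback.condition.trans (congrArg (fun z => pullback.snd _ _ ≫ z) hR.symm)))

variable (J E) in
/-- The choices of factorizations made in the inductive construction of separation grids;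
all of them are independent of each other. -/
structure GridChoices where
  /-- the choices for the generalized diagonal at `(s, k)` -/
  diag : J → ℕ → Factorizations E
  /-- the choices for the further columns of the grid at `(s, k)` -/
  col : J → ℕ → ℕ → Factorizations E
  /-- the choices for the maps out of `objN` at `(s, k)` -/
  low : J → ℕ → Factorizations E

section Step

variable (hY : IsPointed Y) (χ : GridChoices J E) (s : J) (k : ℕ) {n : ℕ}
  (R : Tower n (matchProd Y s k) (doubleProd Y s k)) (hR : R.comp = forgetProd Y s k)

/-- The top row of the separation grid at `(s, k)`, from `objP` to the product of the
objects `Y t` with `deg t = k`. -/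
noncomputable def fRow : Tower (n + 1) (objP hY s k) (eqProd Y s k) :=
  (rightColumn hY s k R).topRow (χ.col s k)
    (firstStep hY s k R hR (χ.diag s k (genDiag Y s k)))
    (pullback.fst (pullback.snd (genDiag Y s k) (forgetProd Y s k)) (structProd hY s k))
    (pullback.snd (pullback.snd (genDiag Y s k) (forgetProd Y s k)) (structProd hY s k))
    pullback.condition.symm

/-- The pullback of the right column of the grid at `(s, k)` along the generalized diagonal,
extended by a factorization of the map out of `objN`. -/
noncomputable def gRow : Tower (n + 1) (objN Y s k) (lowProd Y s k) :=
  (R.pull (genDiag Y s k)).capFac (χ.low s k)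
    (pullback.snd (rForget Y s k) (pullback.fst (genDiag Y s k) (forgetProd Y s k)) ≫
      R.pullLift (genDiag Y s k) (pullback.fst (genDiag Y s k) (forgetProd Y s k))
        (pullback.snd (genDiag Y s k) (forgetProd Y s k))
        (pullback.condition.trans (congrArg (fun z => pullback.snd _ _ ≫ z) hR.symm)))

/-- The decomposition of the reduced forgetful map of the reduced matching object in degrees
at most `k`, obtained from the grid at `(s, k)`. -/
noncomputable def nextTower :
    Tower (n + 1) (rMatching Y s (k + 1)) (lowProd Y s (k + 1)) :=
  (((fRow hY χ s k R hR).prod (gRow χ s k R hR)).precomp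
    (prod.lift ((univCone Y s (k + 1)).alpha hY)
      ((univCone Y s (k + 1)).restrict (Nat.le_succ k)).beta)).postcomp (joinProd Y s k)

lemma fRow_comp : (fRow hY χ s k R hR).comp =
    pullback.snd (pullback.snd (genDiag Y s k) (forgetProd Y s k)) (structProd hY s k) :=
  Column.topRow_comp _ _ _ _ _ _

lemma gRow_comp : (gRow χ s k R hR).comp =
    pullback.snd (rForget Y s k) (pullback.fst (genDiag Y s k) (forgetProd Y s k)) ≫
      pullback.fst (genDiag Y s k) (forgetProd Y s k) := by
  rw [gRow, Tower.capFac_comp, Category.assoc, Tower.pullLift_comp]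

lemma univCone_toLow (m : ℕ) : (univCone Y s m).toLow = rForget Y s m := by
  have h := (univCone Y s m).toRMatching_unique (𝟙 _) (fun a ha => Category.id_comp _)
  rw [← PtCone.toRMatching_rForget, ← h, Category.id_comp]

lemma nextTower_comp : (nextTower hY χ s k R hR).comp = rForget Y s (k + 1) := by
  refine (Tower.postcomp_comp _ _).trans ?_
  rw [Tower.precomp_comp, Tower.prod_comp, prod.lift_map, fRow_comp, gRow_comp]
  refine Eq.trans ?_ ((lift_joinProd (univCone Y s (k + 1))).trans (univCone_toLow s (k + 1)))
  congr 2
  · exact pullback.lift_snd _ _ _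
  · refine (Category.assoc _ _ _).symm.trans ?_
    refine (congrArg (fun z => z ≫ pullback.fst (genDiag Y s k) (forgetProd Y s k))
      (pullback.lift_snd _ _ _)).trans ?_
    exact PtCone.eta_fst _

end Step

/-- The inductively constructed decomposition of the reduced forgetful map of the reduced
matching object at `s` in degrees at most `n + 1`, as a composite of `n + 1` maps. -/
noncomputable def sepTower (hY : IsPointed Y) (χ : GridChoices J E) : ∀ (n : ℕ) (s : J),
    {t : Tower n (rMatching Y s (n + 2)) (lowProd Y s (n + 2)) // t.comp = rForget Y s (n + 2)}
  | 0, s => ⟨Tower.last (rForget Y s 2), rfl⟩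
  | n + 1, s =>
    ⟨nextTower hY χ s (n + 2)
        (Tower.pi fun g : EqIdx P s (n + 2) => (sepTower hY χ n g.1.right.obj).1)
        ((Tower.pi_comp _).trans
          (congrArg Limits.Pi.map (funext fun g => (sepTower hY χ n g.1.right.obj).2))),
      nextTower_comp _ _ _ _ _ _⟩

/-- The right column of the separation grid at `(x, m + 2)`, without its top map: a
decomposition of the product of the reduced forgetful maps into `m + 1` maps. -/
noncomputable def sepColumn (hY : IsPointed Y) (χ : GridChoices J E) (x : J) (m : ℕ) :
    Tower m (matchProd Y x (m + 2)) (doubleProd Y x (m + 2)) :=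
  Tower.pi fun g : EqIdx P x (m + 2) => (sepTower hY χ m g.1.right.obj).1

lemma sepColumn_comp (hY : IsPointed Y) (χ : GridChoices J E) (x : J) (m : ℕ) :
    (sepColumn hY χ x m).comp = forgetProd Y x (m + 2) :=
  (Tower.pi_comp _).trans
    (congrArg Limits.Pi.map (funext fun g => (sepTower hY χ m g.1.right.obj).2))

/-- The conditions on the right column of a separation grid at `(x, k)`: the column, without
its top map, decomposes the product of the reduced forgetful maps, all maps other than the
one out of the product of matching objects are fibrations, that one is a monomorphism, and
the two objects at its ends are fibrant. -/
structure IsSeparating (hY : IsPointed Y) (x : J) (k : ℕ) {n : ℕ}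
    (R : Tower n (matchProd Y x k) (doubleProd Y x k)) : Prop where
  comp_eq : R.comp = forgetProd Y x k
  fibration_cap : Fibration (structProd hY x k)
  fibrations : R.FibrationsBelowTop
  mono : R.MonoTop
  fibrant_mid : IsFibrant (matchProd Y x k)
  fibrant_base : IsFibrant (doubleProd Y x k)

end SeparationGrid

/-! ## Homotopy operations -/

section Operations

variable {E : Type u} [Category.{v} E] [ModelCategory E]

/-- The total higher homotopy operation associated to a solid diagram
`A ⟶ B' ⟶ B ⟵ F1` and maps `σ : X ⟶ A` and `φ : X ⟶ F1`. It is the set of homotopy classes of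
maps `θ : X ⟶ F2` into the pullback `F2` of `F1` and `B'` over `B` such that the composites
`X ⟶ F2 ⟶ F1 ⟶ B` and `X ⟶ A ⟶ B' ⟶ B` agree and `X ⟶ F2 ⟶ F1` is homotopic to `φ`. -/
def totalOperation {X A B' B F1 : E} (α : A ⟶ B') (β : B' ⟶ B) (Ψ : F1 ⟶ B)
    (σ : X ⟶ A) (φ : X ⟶ F1) : Set (LeftHomotopyClass X (pullback Ψ β)) :=
  {c | ∃ θ : X ⟶ pullback Ψ β, c = LeftHomotopyClass.mk θ ∧
    (θ ≫ pullback.fst Ψ β) ≫ Ψ = (σ ≫ α) ≫ β ∧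
    LeftHomotopyRel (θ ≫ pullback.fst Ψ β) φ}

namespace Column

variable {Q X : E} {n : ℕ}

/-- The separated higher homotopy operation at a column `c` whose next column is given by the
step `S`, for a map `κ` to the top of the column `c` and a map `η` to `Q`. It consists of the
homotopy classes of maps `θ` from `X` to the first object above the base of the next column
whose composite with the map to the base is homotopic to the one determined by `η`, and which
are strictly compatible with `κ`: after projection to the column `c` in all columns but
the last one, and after further projection to the base in the last one. -/
def separatedOperation (c : Column Q n) (S : c.Step) (η : X ⟶ Q) (κ : X ⟶ c.top) :
    Set (LeftHomotopyClass X (c.next S).tower.fst) :=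
  {z | ∃ θ : X ⟶ (c.next S).tower.fst, z = LeftHomotopyClass.mk θ ∧
    LeftHomotopyRel (θ ≫ (c.next S).tower.low) (η ≫ S.a) ∧
    (n ≠ 0 → θ ≫ c.tower.pullFstProj S.q = (κ ≫ c.cap) ≫ c.tower.toFst) ∧
    (n = 0 → (θ ≫ (c.next S).tower.low) ≫ S.q = (κ ≫ c.cap) ≫ c.tower.comp)}

/-- The class at which a separated operation has to vanish. -/
noncomputable def vanishingClass (c : Column Q n) (S : c.Step) (η : X ⟶ Q) :
    LeftHomotopyClass X (c.next S).tower.fst :=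
  LeftHomotopyClass.mk (η ≫ (c.next S).γ ≫ (c.next S).tower.toFst)

/-- A separated operation is defined if the two maps to the base agree up to homotopy. -/
def SeparatedDefined (c : Column Q n) (S : c.Step) (η : X ⟶ Q) (κ : X ⟶ c.top) : Prop :=
  LeftHomotopyRel (κ ≫ c.cap ≫ c.tower.comp) (η ≫ S.a ≫ S.q)

/-- The separated operations of the columns following `c`, of which there are `n + 1`, vanish
in turn: the first one is defined and vanishes, and if it is not the last one, the given
map `κ` has a lift to the next column, as in the vanishing of that operation, for which the
remaining operations vanish in turn. -/
def VanishInTurn (φ : ℕ → Factorizations E) {n : ℕ} (c : Column Q n) (S : c.Step) (η : X ⟶ Q)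
    (κ : X ⟶ c.top) : Prop :=
  match n, c, S, κ with
  | 0, c, S, κ => c.SeparatedDefined S η κ ∧
      c.vanishingClass S η ∈ c.separatedOperation S η κ
  | n + 1, c, S, κ => c.SeparatedDefined S η κ ∧
      c.vanishingClass S η ∈ c.separatedOperation S η κ ∧
      ∃ κ' : X ⟶ (c.next S).top, κ' ≫ c.u S = κ ∧
        LeftHomotopyRel (κ' ≫ (c.next S).cap ≫ (c.next S).tower.toFst)
          (η ≫ (c.next S).γ ≫ (c.next S).tower.toFst) ∧
        VanishInTurn φ (c.next S).drop ((c.next S).drop.step (φ n)) η κ'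

end Column

end Operations

/-! ## The extension problem -/

section Extension

variable {J : Type w} [SmallCategory J] [WeakLattice J] [PointedIndexing J]
variable {E : Type u} [Category.{v} E] [ModelCategory E] [HasZeroMorphisms E]

/-- A pointed diagram is pointed Reedy fibrant if all structure maps to the reduced matching
objects are fibrations. -/
def PointedReedyFibrant {P : ObjectProperty J} {Y : P.FullSubcategory ⥤ E}
    (hY : IsPointed Y) : Prop :=
  ∀ t : P.FullSubcategory, Fibration (structureMap hY t (deg t.obj))

/-- The object `x` of the category `J_x^k`. -/
abbrev vertex (x : J) (k : ℕ) : (under x k).FullSubcategory := ⟨x, Or.inl rfl⟩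

variable {H : Type u'} [Category.{v'} H]

/-- The data of the extension problem at `x`, at stage `k = m + 2`: a pointed diagram up to
homotopy on `J_x^k`, a strict pointed diagram lifting it on `J_x^{k-1}`, and a
strict pointed Reedy fibrant diagram lifting it on `∂J_x^k`, which agree on `∂J_x^{k-1}`.
The value at `x` is cofibrant. Here `L` is the localization functor to the homotopy
category. -/
structure ExtensionData (L : E ⥤ H) (x : J) (m : ℕ) where
  /-- the diagram up to homotopy -/
  Yho : (under x (m + 2)).FullSubcategory ⥤ H
  /-- the strict diagram which is already defined at `x` -/
  Yx : (under x (m + 1)).FullSubcategory ⥤ E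
  /-- the strict diagram below `x` -/
  Yk : (bdry x (m + 2)).FullSubcategory ⥤ E
  pointed_Yho : IsPointedHo Yho
  pointed_Yx : IsPointed Yx
  pointed_Yk : IsPointed Yk
  agree : ObjectProperty.ιOfLE (bdry_mono x (Nat.le_succ (m + 1))) ⋙ Yk =
    ObjectProperty.ιOfLE (bdry_le_under x (m + 1)) ⋙ Yx
  lift_Yx : Yx ⋙ L = ObjectProperty.ιOfLE (under_mono x (Nat.le_succ (m + 1))) ⋙ Yho
  lift_Yk : Yk ⋙ L = ObjectProperty.ιOfLE (bdry_le_under x (m + 2)) ⋙ Yho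
  reedyFibrant : PointedReedyFibrant pointed_Yk
  cofibrant : IsCofibrant (Yx.obj (vertex x (m + 1)))

namespace ExtensionData

variable {L : E ⥤ H} {x : J} {m : ℕ} (S : ExtensionData L x m)

/-- The value `Y x`. -/
abbrev X : E := S.Yx.obj (vertex x (m + 1))

/-- A further extension: a strict pointed diagram on `J_x^k` which restricts to the two given
strict diagrams and lifts the given diagram up to homotopy. -/
def HasExtension : Prop :=
  ∃ Y : (under x (m + 2)).FullSubcategory ⥤ E, IsPointed Y ∧
    ObjectProperty.ιOfLE (bdry_le_under x (m + 2)) ⋙ Y = S.Yk ∧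
    ObjectProperty.ιOfLE (under_mono x (Nat.le_succ (m + 1))) ⋙ Y = S.Yx ∧
    Y ⋙ L = S.Yho

lemma obj_eq (t : J) (h : bdry x (m + 1) t) :
    S.Yx.obj ⟨t, Or.inr h⟩ = S.Yk.obj ⟨t, bdry_mono x (Nat.le_succ (m + 1)) t h⟩ :=
  (Functor.congr_obj S.agree ⟨t, h⟩).symm

/-- The identification of the values of the two strict diagrams. -/
def compare (t : J) (h : bdry x (m + 1) t) :
    S.Yx.obj ⟨t, Or.inr h⟩ ⟶ S.Yk.obj ⟨t, bdry_mono x (Nat.le_succ (m + 1)) t h⟩ :=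
  eqToHom (S.obj_eq t h)

lemma compare_naturality {t t' : J} (h : bdry x (m + 1) t) (h' : bdry x (m + 1) t')
    (f : t ⟶ t') :
    S.compare t h ≫ S.Yk.map (X := ⟨t, bdry_mono x (Nat.le_succ (m + 1)) t h⟩)
        (Y := ⟨t', bdry_mono x (Nat.le_succ (m + 1)) t' h'⟩) (ObjectProperty.homMk f) =
      S.Yx.map (X := ⟨t, Or.inr h⟩) (Y := ⟨t', Or.inr h'⟩) (ObjectProperty.homMk f) ≫
        S.compare t' h' := by
  have e := Functor.congr_hom S.agree (X := ⟨t, h⟩) (Y := ⟨t', h'⟩) (ObjectProperty.homMk f)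
  have e' : S.Yk.map (X := ⟨t, bdry_mono x (Nat.le_succ (m + 1)) t h⟩)
        (Y := ⟨t', bdry_mono x (Nat.le_succ (m + 1)) t' h'⟩) (ObjectProperty.homMk f) =
      eqToHom (S.obj_eq t h).symm ≫
        S.Yx.map (X := ⟨t, Or.inr h⟩) (Y := ⟨t', Or.inr h'⟩) (ObjectProperty.homMk f) ≫
        S.compare t' h' := e
  rw [e', compare, eqToHom_trans_assoc, eqToHom_refl, Category.id_comp]

lemma bdry_of_lt (a : Out (bdry x (m + 2)) x)
    (ha : deg a.right.obj < m + 2) : bdry x (m + 1) a.right.obj :=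
  ⟨a.right.property.1, Nat.le_of_lt_succ ha⟩

/-- The value at `a : x ⟶ t`, with `deg t < k`, of the strict diagram on `J_x^{k-1}`. -/
def leg (a : Out (bdry x (m + 2)) x) (ha : deg a.right.obj < m + 2) :
    S.X ⟶ S.Yk.obj a.right :=
  S.Yx.map (Y := ⟨a.right.obj, Or.inr (bdry_of_lt a ha)⟩) (ObjectProperty.homMk a.hom) ≫
    S.compare a.right.obj (bdry_of_lt a ha)

/-- The pointed cone, in degrees less than `k`, given by the strict diagram on `J_x^{k-1}`. -/
def cone : PtCone S.Yk x (m + 2) S.X where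
  leg := S.leg
  natural {a b} f ha hb := by
    have h := S.compare_naturality (bdry_of_lt a ha) (bdry_of_lt b hb) f.right.hom
    have h2 : a.hom ≫ f.right.hom = b.hom := StructuredArrow.w f
    have h3 : S.Yx.map (X := vertex x (m + 1)) (Y := ⟨b.right.obj, Or.inr (bdry_of_lt b hb)⟩)
        (ObjectProperty.homMk b.hom) =
        S.Yx.map (X := vertex x (m + 1)) (Y := ⟨a.right.obj, Or.inr (bdry_of_lt a ha)⟩)
          (ObjectProperty.homMk a.hom) ≫
        S.Yx.map (X := ⟨a.right.obj, Or.inr (bdry_of_lt a ha)⟩)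
          (Y := ⟨b.right.obj, Or.inr (bdry_of_lt b hb)⟩) (ObjectProperty.homMk f.right.hom) := by
      rw [← Functor.map_comp]
      exact congrArg (fun z => S.Yx.map (ObjectProperty.homMk z)) h2.symm
    refine (Category.assoc _ _ _).trans ((congrArg (fun z => S.Yx.map _ ≫ z) h).trans ?_)
    refine (Category.assoc _ _ _).symm.trans ?_
    exact congrArg (fun z => z ≫ S.compare _ (bdry_of_lt b hb)) h3.symm
  leg_null a ha hn :=
    (congrArg (fun z => z ≫ S.compare _ (bdry_of_lt a ha)) (S.pointed_Yx _ hn)).trans zero_comp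

/-- A choice, for every non-null morphism `g : x ⟶ t` with `deg t = k`, of a map in the model
category representing the value of the diagram up to homotopy at `g`. -/
structure Representatives where
  /-- the representative of the value at `g` -/
  map : ∀ g : EqIdx (bdry x (m + 2)) x (m + 2), S.X ⟶ S.Yk.obj g.1.right
  lift : ∀ g : EqIdx (bdry x (m + 2)) x (m + 2),
    L.map (map g) = eqToHom (Functor.congr_obj S.lift_Yx (vertex x (m + 1))) ≫
      S.Yho.map (X := vertex x (m + 2)) (Y := ⟨g.1.right.obj, Or.inr g.1.right.property⟩)
        (ObjectProperty.homMk g.1.hom) ≫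
      eqToHom (Functor.congr_obj S.lift_Yk g.1.right).symm

variable {S}

/-- The map from `Y x` to the product of the `Y t`, `deg t = k`, given by representatives. -/
noncomputable def Representatives.sigma (ρ : S.Representatives) :
    S.X ⟶ eqProd S.Yk x (m + 2) :=
  Pi.lift ρ.map

variable (S)

/-- A choice of a factorization of the generalized diagonal as a weak equivalence followed by a
fibration. -/
abbrev DiagFactorization : Type (max u v) :=
  MorphismProperty.MapFactorizationData (weakEquivalences E) (fibrations E)
    (genDiag S.Yk x (m + 2))

variable {S}

/-- The total pointed higher homotopy operation. -/
def total (ρ : S.Representatives) (F : S.DiagFactorization) :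
    Set (LeftHomotopyClass S.X (pullback F.p (forgetProd S.Yk x (m + 2)))) :=
  totalOperation (structProd S.pointed_Yk x (m + 2)) (forgetProd S.Yk x (m + 2)) F.p
    ρ.sigma (S.cone.toLow ≫ F.i)

/-- The map from `objQ` to the target of the total pointed higher homotopy operation. -/
noncomputable def gamma (F : S.DiagFactorization) :
    objQ S.Yk x (m + 2) ⟶ pullback F.p (forgetProd S.Yk x (m + 2)) :=
  pullback.lift (pullback.fst (genDiag S.Yk x (m + 2)) (forgetProd S.Yk x (m + 2)) ≫ F.i)
    (pullback.snd (genDiag S.Yk x (m + 2)) (forgetProd S.Yk x (m + 2)))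
    (by rw [Category.assoc, F.fac]; exact pullback.condition)

/-- The total pointed higher homotopy operation vanishes if it contains the class determined
by the strict diagram on `J_x^{k-1}`. -/
def TotalVanishes (ρ : S.Representatives) (F : S.DiagFactorization) : Prop :=
  LeftHomotopyClass.mk (S.cone.eta ≫ gamma F) ∈ total ρ F

/-- The `k - 1 = m + 1` separated pointed higher homotopy operations, of orders
`2, ..., k`, obtained from a right column `R` and choices of factorizations,
vanish in turn. -/
def SeparatedVanish (ρ : S.Representatives) (F : S.DiagFactorization)
    (R : Tower m (matchProd S.Yk x (m + 2)) (doubleProd S.Yk x (m + 2)))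
    (hR : R.comp = forgetProd S.Yk x (m + 2)) (φ : ℕ → Factorizations E) : Prop :=
  (rightColumn S.pointed_Yk x (m + 2) R).VanishInTurn φ
    (firstStep S.pointed_Yk x (m + 2) R hR F) S.cone.eta ρ.sigma

end ExtensionData

end Extension

end HigherOp

namespace HigherOp

/-! ### Formal properties of towers and their pullbacks -/

section Towers

variable {E : Type u} [Category.{v} E]

namespace Tower

/-! All three conditions are equivalent to one homotopy in `M`: the map `ασ` is left homotopic to `ρ
: Y(x) ⟶ M`, the second component of `η`, which records what the strict diagram on `J_x^{k-1}`
prescribes on the reduced matching objects of the objects of degree `k`. Three mechanisms recur.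
First, `Y(x)` is cofibrant, so a homotopy into the base of a fibration lifts once one end is lifted
(`exists_lift_of_leftHomotopyRel`). Second, `β` is a monomorphism, because a matching object embeds
in a product; a strict equation after mapping to `B` therefore already holds in `M`. Third, maps
into a reduced matching object are the same as pointed cones.

Extension (`hasExtension_iff`): a functor on `J_x^k` extending the one on `∂J_x^k` amounts to a
pointed cone with vertex `Y(x)`. Enlarging the given cone from degrees `< k` to degrees `≤ k`
amounts to a map `σ'` into `A` with `ασ' = ρ`. The prescribed homotopy classes say exactly that `σ'
~ σ`, since `Y(x)` is cofibrant and the objects of the diagram are fibrant. As `α` is a fibration,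
such a `σ'` exists if and only if `ασ ~ ρ`.

Total operation (`totalVanishes_iff`): the equation in `B` forces the `M`-component of `θ` to be
`ασ`, while that of `γη` is `ρ`. Thus `θ ~ γη` projects to `ασ ~ ρ`; conversely this homotopy lifts
along the fibration from `F^2` to `M`.

Separated operations (`Column.vanishInTurn_iff`): the same argument is run column by column. The
homotopy between the two maps into the second row lifts along the fibration between the second rows
of adjacent columns, and it can be projected back. In the last column the monomorphism at the top
turns the equation in the base into one in the second row.

The inductive towers are admissible right columns (`isSeparating_sepColumn`) because their maps
below the top are built from base changes, products and factorizations that are fibrations. The top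
map is mono as the first factor of the monomorphism `β`. The end objects are fibrant because reduced
matching objects are iterated pullbacks along products of Reedy structure maps
(`isPullback_rMatching`). -/

lemma monoTop_of_mono_comp {n : ℕ} {T B : E} (t : Tower n T B) (h : Mono t.comp) : t.MonoTop := by
  induction t with
  | last f => exact h
  | cons p t ih =>
    have : Mono (t.comp ≫ p) := h
    exact ih (mono_of_mono t.comp p)

lemma MonoTop.tail {n : ℕ} {T B : E} {t : Tower (n + 1) T B} (h : t.MonoTop) :
    t.tail.MonoTop := by
  cases t with
  | cons p t => exact h

lemma MonoTop.mono_low {T B : E} {t : Tower 0 T B} (h : t.MonoTop) : Mono t.low := by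
  cases t with
  | last f => exact h

lemma isIso_toFst {T B : E} (t : Tower 0 T B) : IsIso t.toFst := by
  cases t with
  | last f => exact (inferInstance : IsIso (𝟙 T))

lemma FibrationsBelowTop.low [CategoryWithFibrations E] {n : ℕ} {T B : E}
    {t : Tower (n + 1) T B} (h : t.FibrationsBelowTop) : Fibration t.low := by
  cases t with
  | cons p t => exact h.1

lemma FibrationsBelowTop.tail [CategoryWithFibrations E] {n : ℕ} {T B : E}
    {t : Tower (n + 1) T B} (h : t.FibrationsBelowTop) : t.tail.FibrationsBelowTop := by
  cases t with
  | cons p t => exact h.2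

lemma FibrationsBelowTop.precomp [CategoryWithFibrations E] {n : ℕ} {T T' B : E}
    {t : Tower n T B} (h : t.FibrationsBelowTop) (g : T' ⟶ T) :
    (t.precomp g).FibrationsBelowTop := by
  induction t with
  | last f => trivial
  | cons p t ih => exact ⟨h.1, ih h.2 g⟩

section Pullbacks

variable [HasPullbacks E]

/-- Pasting the pullback squares of the successive levels gives a single pullback square for the
composite of the tower. -/
lemma isPullback_pull {n : ℕ} {T B D : E} (t : Tower n T B) (q : D ⟶ B) :
    IsPullback (t.pull q).comp (t.pullProj q) q t.comp := by
  induction t generalizing D with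
  | last f => exact IsPullback.of_hasPullback q f
  | cons p t ih =>
    exact ((ih (pullback.snd q p)).flip.paste_vert (IsPullback.of_hasPullback q p).flip).flip

lemma pull_toFst_pullFstProj {n : ℕ} {T B D : E} (t : Tower n T B) (q : D ⟶ B) :
    (t.pull q).toFst ≫ t.pullFstProj q = t.pullProj q ≫ t.toFst := by
  cases t with
  | last f => exact (Category.id_comp _).trans (Category.comp_id _).symm
  | cons p t => exact (t.isPullback_pull (pullback.snd q p)).w

lemma pull_low {n : ℕ} {T B D : E} (t : Tower n T B) (q : D ⟶ B) :
    (t.pull q).low ≫ q = t.pullFstProj q ≫ t.low := by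
  cases t with
  | last f => exact pullback.condition
  | cons p t => exact pullback.condition

lemma MonoTop.pull {n : ℕ} {T B D : E} {t : Tower n T B} (h : t.MonoTop) (q : D ⟶ B) :
    (t.pull q).MonoTop := by
  induction t generalizing D with
  | last f =>
    have : Mono f := h
    exact (inferInstance : Mono (pullback.fst q f))
  | cons p t ih => exact ih h _

end Pullbacks

end Tower

end Towers

/-! ### Fibrations in towers, and vanishing of the separated operations -/

section ModelTowers

variable {E : Type u} [Category.{v} E] [ModelCategory E]

namespace Tower

lemma FibrationsBelowTop.pull {n : ℕ} {T B D : E} {t : Tower n T B} (h : t.FibrationsBelowTop)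
    (q : D ⟶ B) : (t.pull q).FibrationsBelowTop := by
  induction t generalizing D with
  | last f => trivial
  | cons p t ih =>
    have : Fibration p := h.1
    exact ⟨(inferInstance : Fibration (pullback.fst q p)), ih h.2 _⟩

lemma FibrationsBelowTop.postcomp {n : ℕ} {T B B' : E} {t : Tower n T B}
    (h : t.FibrationsBelowTop) (f : B ⟶ B') [Fibration f] : (t.postcomp f).FibrationsBelowTop := by
  cases t with
  | last g => trivial
  | cons p t =>
    have : Fibration p := h.1
    exact ⟨(inferInstance : Fibration (p ≫ f)), h.2⟩

lemma FibrationsBelowTop.prod {n : ℕ} {T B T' B' : E} {t : Tower n T B} {t' : Tower n T' B'}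
    (h : t.FibrationsBelowTop) (h' : t'.FibrationsBelowTop) :
    (t.prod t').FibrationsBelowTop := by
  induction t generalizing T' B' with
  | last f => cases t' with
    | last f' => trivial
  | cons p t ih => cases t' with
    | cons p' t' =>
      have : Fibration p := h.1
      have : Fibration p' := h'.1
      exact ⟨(inferInstance : Fibration (Limits.prod.map p p')), ih h.2 h'.2⟩

lemma FibrationsBelowTop.pi {I : Type w} [Finite I] {n : ℕ} {T B : I → E}
    {t : ∀ i, Tower n (T i) (B i)} (h : ∀ i, (t i).FibrationsBelowTop) :
    (Tower.pi t).FibrationsBelowTop := by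
  induction n generalizing B with
  | zero => trivial
  | succ n ih =>
    have : ∀ i, Fibration (t i).low := fun i => (h i).low
    exact ⟨(inferInstance : Fibration (Limits.Pi.map fun i => (t i).low)),
      ih fun i => (h i).tail⟩

lemma FibrationsBelowTop.capFac (φ : Factorizations E) {n : ℕ} {T B X : E} (f : X ⟶ T)
    {t : Tower n T B} (h : t.FibrationsBelowTop) : (t.capFac φ f).FibrationsBelowTop := by
  induction t with
  | last z => exact ⟨(fibration_iff _).2 (φ (f ≫ z)).hp, trivial⟩
  | cons p t ih => exact ⟨h.1, ih f h.2⟩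

/-- By the pasted square, this projection is a base change of `q`. -/
lemma fibration_pullProj {n : ℕ} {T B D : E} (t : Tower n T B) (q : D ⟶ B) [hq : Fibration q] :
    Fibration (t.pullProj q) := by
  rw [fibration_iff] at hq ⊢
  exact MorphismProperty.of_isPullback (t.isPullback_pull q) hq

end Tower

namespace Column

variable {Q X : E} {n : ℕ}

lemma fibration_step (c : Column Q n) (φ : Factorizations E) : Fibration (c.step φ).q :=
  (fibration_iff _).2 (φ (c.γ ≫ c.tower.comp)).hp

lemma fibration_u (c : Column Q n) (S : c.Step) [Fibration S.q] : Fibration (c.u S) := by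
  have := c.tower.fibration_pullProj S.q
  exact (inferInstance : Fibration (pullback.snd (c.tower.pullProj S.q) c.cap))

/-- Each map of the top row other than the first one out of `P` is a base change of the projection
between second rows, hence of the fibration chosen in that step. -/
lemma topRow_fibrationsBelowTop (φ : ℕ → Factorizations E) {n : ℕ} (c : Column Q n) (S : c.Step)
    [Fibration S.q] {P : E} (p : P ⟶ Q) (f : P ⟶ c.top) (h : f ≫ c.cap = p ≫ c.γ) :
    (c.topRow φ S p f h).FibrationsBelowTop := by
  induction n with
  | zero => exact ⟨c.fibration_u S, trivial⟩
  | succ n ih =>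
    have := (c.next S).drop.fibration_step (φ n)
    exact ⟨c.fibration_u S, ih _ _ _ _⟩

end Column

/-- For cofibrant `X` an end inclusion into a good cylinder is a trivial cofibration, so the
homotopy lifts against `p` starting from `f'`. The other end of the lifted homotopy is `g'`. No
fibrancy of `Z` or `W` is involved. -/
lemma exists_lift_of_leftHomotopyRel {X Z W : E} [IsCofibrant X] (p : Z ⟶ W) [Fibration p]
    {f g : X ⟶ W} (h : LeftHomotopyRel f g) (f' : X ⟶ Z) (hf : f' ≫ p = f) :
    ∃ g' : X ⟶ Z, g' ≫ p = g ∧ LeftHomotopyRel f' g' := by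
  obtain ⟨P, _, ⟨h⟩⟩ := h.exists_good_cylinder
  obtain ⟨g', h', e⟩ := h.covering_homotopy p f' hf
  refine ⟨g', ?_, h'.leftHomotopyRel⟩
  rw [← h'.h₁, Category.assoc, e, h.h₁]

namespace Column

variable {Q X : E} {n : ℕ}

/-- The projection between the bases of adjacent columns. -/
def baseProj (c : Column Q n) (S : c.Step) : (c.next S).base ⟶ c.base := S.q

/-- The projection between the second rows of adjacent columns. -/
noncomputable def midProj (c : Column Q n) (S : c.Step) : (c.next S).mid ⟶ c.mid :=
  c.tower.pullProj S.q

/-- The projection between the first objects above the bases of adjacent columns. -/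
noncomputable def fstProj (c : Column Q n) (S : c.Step) :
    (c.next S).tower.fst ⟶ c.tower.fst :=
  c.tower.pullFstProj S.q

lemma fibration_midProj (c : Column Q n) (S : c.Step) [Fibration S.q] :
    Fibration (c.midProj S) :=
  c.tower.fibration_pullProj S.q

lemma next_γ_midProj (c : Column Q n) (S : c.Step) : (c.next S).γ ≫ c.midProj S = c.γ :=
  c.tower.pullLift_proj _ _ _ _

lemma next_γ_comp (c : Column Q n) (S : c.Step) :
    (c.next S).γ ≫ (c.next S).tower.comp = S.a :=
  c.tower.pullLift_comp _ _ _ _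

lemma next_cap_midProj (c : Column Q n) (S : c.Step) :
    (c.next S).cap ≫ c.midProj S = c.u S ≫ c.cap :=
  pullback.condition

lemma next_comp_baseProj (c : Column Q n) (S : c.Step) :
    (c.next S).tower.comp ≫ c.baseProj S = c.midProj S ≫ c.tower.comp :=
  (c.tower.isPullback_pull S.q).w

lemma next_toFst_fstProj (c : Column Q n) (S : c.Step) :
    (c.next S).tower.toFst ≫ c.fstProj S = c.midProj S ≫ c.tower.toFst :=
  c.tower.pull_toFst_pullFstProj S.q

lemma next_low_baseProj (c : Column Q n) (S : c.Step) :
    (c.next S).tower.low ≫ c.baseProj S = c.fstProj S ≫ c.tower.low :=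
  c.tower.pull_low S.q

lemma separatedDefined_of_leftHomotopyRel (c : Column Q n) (S : c.Step) {η : X ⟶ Q}
    {κ : X ⟶ c.top} (h : LeftHomotopyRel (κ ≫ c.cap) (η ≫ c.γ)) : c.SeparatedDefined S η κ := by
  have := h.postcomp c.tower.comp
  rw [Category.assoc, Category.assoc, ← S.w] at this
  exact this

/-- A homotopy between the two maps from `X` to the second row of a column lifts to the next
column. -/
lemma exists_lift_next [IsCofibrant X] (c : Column Q n) (S : c.Step) [Fibration S.q] {η : X ⟶ Q}
    {κ : X ⟶ c.top} (h : LeftHomotopyRel (κ ≫ c.cap) (η ≫ c.γ)) :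
    ∃ κ' : X ⟶ (c.next S).top, κ' ≫ c.u S = κ ∧
      LeftHomotopyRel (κ' ≫ (c.next S).cap) (η ≫ (c.next S).γ) := by
  have := c.fibration_midProj S
  -- The end `η ≫ c.γ` has the canonical lift `η ≫ (c.next S).γ`. Transporting it along the homotopy
  -- gives a lift `θ` of `κ ≫ c.cap`, and the pair `(θ, κ)` is a map into the pullback `(c.next
  -- S).top`.
  obtain ⟨θ, hθ, hh⟩ := exists_lift_of_leftHomotopyRel (c.midProj S) h.symm
    (η ≫ (c.next S).γ) (by rw [Category.assoc, next_γ_midProj])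
  obtain ⟨κ', h1, h2⟩ : ∃ κ' : X ⟶ (c.next S).top, κ' ≫ (c.next S).cap = θ ∧ κ' ≫ c.u S = κ :=
    ⟨pullback.lift θ κ hθ, pullback.lift_fst _ _ _, pullback.lift_snd _ _ _⟩
  exact ⟨κ', h2, h1 ▸ hh.symm⟩

/-- The witness is the image of `κ'` in the first object above the base: it satisfies the strict
equations because `κ'` lifts `κ`, and it lies in the vanishing class because of the homotopy in the
second row. -/
lemma vanishingClass_mem (c : Column Q n) (S : c.Step) {η : X ⟶ Q}
    {κ : X ⟶ c.top} (κ' : X ⟶ (c.next S).top) (hκ : κ' ≫ c.u S = κ)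
    (h : LeftHomotopyRel (κ' ≫ (c.next S).cap) (η ≫ (c.next S).γ)) :
    c.vanishingClass S η ∈ c.separatedOperation S η κ := by
  have h1 := h.postcomp (c.next S).tower.toFst
  refine ⟨κ' ≫ (c.next S).cap ≫ (c.next S).tower.toFst, ?_, ?_, fun _ => ?_, fun _ => ?_⟩
  · rw [vanishingClass, ← Category.assoc, ← Category.assoc]
    exact LeftHomotopyClass.sound h1.symm
  · have := h.postcomp (c.next S).tower.comp
    rw [Category.assoc η, next_γ_comp] at this
    simpa only [Category.assoc, Tower.toFst_low] using this
  · change (κ' ≫ (c.next S).cap ≫ (c.next S).tower.toFst) ≫ c.fstProj S = _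
    simp only [Category.assoc]
    rw [next_toFst_fstProj, ← Category.assoc (c.next S).cap, next_cap_midProj, ← hκ]
    simp only [Category.assoc]
  · change _ ≫ c.baseProj S = _
    simp only [Category.assoc]
    rw [← Category.assoc (c.next S).tower.toFst, Tower.toFst_low, next_comp_baseProj,
      ← Category.assoc (c.next S).cap, next_cap_midProj, ← hκ]
    simp only [Category.assoc]

/-- The separated operations vanish in turn if and only if the two maps from `X` to the second
row of the right column are homotopic. -/
theorem vanishInTurn_iff [IsCofibrant X] (φ : ℕ → Factorizations E) {n : ℕ} (c : Column Q n)
    (S : c.Step) [Fibration S.q] (hc : c.tower.MonoTop) (η : X ⟶ Q) (κ : X ⟶ c.top) :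
    c.VanishInTurn φ S η κ ↔ LeftHomotopyRel (κ ≫ c.cap) (η ≫ c.γ) := by
  induction n with
  | zero =>
    refine ⟨?_, fun h => ?_⟩
    · rintro ⟨-, θ, e, -, -, h⟩
      have e' : LeftHomotopyRel (η ≫ (c.next S).γ ≫ (c.next S).tower.toFst) θ :=
        (LeftHomotopyClass.mk_eq_mk_iff _ _).1 e
      have := hc.mono_low
      have := c.tower.isIso_toFst
      have h' : (θ ≫ (c.next S).tower.low) ≫ c.baseProj S = _ := h rfl
      -- The last tower consists of a single monomorphism. Cancelling it upgrades the equation in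
      -- the base to one above it, which is what the definition imposes directly in all earlier
      -- columns.
      have hθ : θ ≫ c.fstProj S = (κ ≫ c.cap) ≫ c.tower.toFst := by
        rw [← cancel_mono c.tower.low, Category.assoc, ← next_low_baseProj, ← Category.assoc, h',
          Category.assoc (κ ≫ c.cap), Tower.toFst_low]
      have e2 := e'.postcomp (c.fstProj S)
      rw [hθ, Category.assoc, Category.assoc, next_toFst_fstProj, ← Category.assoc (c.next S).γ,
        next_γ_midProj, ← Category.assoc η] at e2
      -- For a tower of one map, `toFst` is an identity only after case analysis; its inverse
      -- removes it from both sides.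
      simpa only [Category.assoc, IsIso.hom_inv_id, Category.comp_id] using
        (e2.postcomp (inv c.tower.toFst)).symm
    · obtain ⟨κ', h1, h2⟩ := c.exists_lift_next S h
      exact ⟨c.separatedDefined_of_leftHomotopyRel S h, c.vanishingClass_mem S κ' h1 h2⟩
  | succ n ih =>
    have hfib := (c.next S).drop.fibration_step (φ n)
    have ih' := fun κ' => ih (c.next S).drop ((c.next S).drop.step (φ n))
      (hc.pull S.q).tail κ'
    refine ⟨?_, fun h => ?_⟩
    -- The homotopy comes from the later columns by induction, since dropping the base changes
    -- neither `cap` nor `γ`. Projecting it back along `midProj` gives the homotopy for `κ`.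
    · rintro ⟨-, -, κ', hκ, -, hv⟩
      have h1 : LeftHomotopyRel (κ' ≫ (c.next S).cap) (η ≫ (c.next S).γ) := (ih' κ').1 hv
      have h2 := h1.postcomp (c.midProj S)
      rwa [Category.assoc, next_cap_midProj, ← Category.assoc, hκ, Category.assoc,
        next_γ_midProj] at h2
    · obtain ⟨κ', h1, h2⟩ := c.exists_lift_next S h
      refine ⟨c.separatedDefined_of_leftHomotopyRel S h, c.vanishingClass_mem S κ' h1 h2,
        κ', h1, ?_, (ih' κ').2 h2⟩
      simpa only [Category.assoc] using h2.postcomp (c.next S).tower.toFst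

end Column

end ModelTowers

/-! ### Pointed cones and the inductive description of reduced matching objects -/

section Cones

variable {J : Type w} [SmallCategory J] [WeakLattice J]

lemma deg_le_of_hom {a b : J} (f : a ⟶ b) : deg b ≤ deg a := by
  rcases WeakLattice.id_or_deg_lt f with ⟨h, -⟩ | h
  · rw [h]
  · exact h.le

/-- A morphism that does not lower degree is an identity, and the triangle then identifies the two
structure morphisms. -/
lemma out_hom_eq_eqToHom {P : ObjectProperty J} {s : J} {a b : Out P s} (f : a ⟶ b)
    (h : deg a.right.obj ≤ deg b.right.obj) : ∃ e : a = b, f = eqToHom e := by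
  obtain ⟨⟨⟨⟩⟩, ⟨a, ha⟩, p⟩ := a
  obtain ⟨⟨⟨⟩⟩, ⟨b, hb⟩, q⟩ := b
  rcases WeakLattice.id_or_deg_lt f.right.hom with ⟨e, hf⟩ | hlt
  · dsimp at e
    subst e
    have hw : p ≫ f.right.hom = q := StructuredArrow.w f
    have hpq : p = q := by
      rw [← hw, hf]
      exact (Category.comp_id p).symm
    subst hpq
    refine ⟨rfl, ?_⟩
    ext
    exact hf
  · exact absurd hlt (not_lt.2 h)

variable [PointedIndexing J]
variable {E : Type u} [Category.{v} E] [HasZeroMorphisms E]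
variable {P : ObjectProperty J} {Y : P.FullSubcategory ⥤ E} {s : J}

lemma PtCone.leg_congr {m : ℕ} {X : E} (c : PtCone Y s m X) {a : Out P s}
    (u : s ⟶ a.right.obj) (hu : u = a.hom)
    (ha : deg a.right.obj < m) : c.leg (StructuredArrow.mk (Y := a.right) u) ha = c.leg a ha := by
  subst hu
  rfl

variable [HasFiniteLimits E]

namespace PtCone

variable {X X' : E} {k m : ℕ}

lemma ext_leg {c c' : PtCone Y s m X} (h : ∀ a ha, c.leg a ha = c'.leg a ha) : c = c' := by
  obtain ⟨l, _, _⟩ := c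
  obtain ⟨l', _, _⟩ := c'
  obtain rfl : l = l' := funext fun a => funext fun ha => h a ha
  rfl

/-- The cone obtained by composing with a map to the vertex. -/
def precomp (c : PtCone Y s m X) (z : X' ⟶ X) : PtCone Y s m X' where
  leg a ha := z ≫ c.leg a ha
  natural f ha hb := by rw [Category.assoc, c.natural f ha hb]
  leg_null a ha hn := by rw [c.leg_null a ha hn, comp_zero]

/-- Together with `toRMatching`, this makes maps into the reduced matching object interchangeable
with pointed cones. -/
lemma rMatching_hom_ext {f g : X ⟶ rMatching Y s m}
    (h : ∀ (a : Out P s) (ha : deg a.right.obj < m),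
      f ≫ (univCone Y s m).leg a ha = g ≫ (univCone Y s m).leg a ha) : f = g :=
  (((univCone Y s m).precomp g).toRMatching_unique f h).trans
    (((univCone Y s m).precomp g).toRMatching_unique g fun _ _ => rfl).symm

lemma comp_toRMatching (c : PtCone Y s m X) (z : X' ⟶ X) :
    z ≫ c.toRMatching = (c.precomp z).toRMatching :=
  toRMatching_unique _ _ fun a ha => by rw [Category.assoc, toRMatching_leg]; rfl

lemma univCone_precomp_toRMatching (c : PtCone Y s m X) :
    (univCone Y s m).precomp c.toRMatching = c :=
  ext_leg fun a ha => c.toRMatching_leg a ha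

lemma comp_rho (c : PtCone Y s k X) (z : X' ⟶ X) : z ≫ c.rho = (c.precomp z).rho := by
  refine Pi.hom_ext _ _ fun g => ?_
  rw [rho, rho, Category.assoc, Pi.lift_π, Pi.lift_π, comp_toRMatching]
  rfl

lemma comp_top (c : PtCone Y s (k + 1) X) (z : X' ⟶ X) : z ≫ c.top = (c.precomp z).top := by
  refine Pi.hom_ext _ _ fun g => ?_
  rw [top, top, Category.assoc, Pi.lift_π, Pi.lift_π]
  rfl

lemma rho_eq_top_structProd (hY : IsPointed Y) (c : PtCone Y s (k + 1) X) :
    (c.restrict (Nat.le_succ k)).rho = c.top ≫ structProd hY s k := by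
  rw [← c.eta_structProd hY, eta_snd]

/-- Reading the equation in `M` at the factor `g` and then at the leg `f.right` gives the one
naturality relation from degree `k` to lower degrees that `extend` needs. -/
lemma leg_eq_of_structProd (hY : IsPointed Y) (c : PtCone Y s k X) (σ : X ⟶ eqProd Y s k)
    (h : σ ≫ structProd hY s k = c.rho) (g : EqIdx P s k) {b : Out P s} (f : g.1 ⟶ b)
    (hb : deg b.right.obj < k) :
    (σ ≫ Pi.π (fun g : EqIdx P s k => Y.obj g.1.right) g) ≫ Y.map f.right = c.leg b hb := by
  have h1 : (σ ≫ Pi.π (fun g : EqIdx P s k => Y.obj g.1.right) g) ≫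
      (objCone hY g.1.right k).toRMatching = (c.along g.1).toRMatching := by
    have := congrArg (fun z => z ≫ Pi.π _ g) h
    simp only [rho, Category.assoc, Pi.map_π, Pi.lift_π] at this
    exact (Category.assoc _ _ _).trans this
  have h2 := congrArg (fun z => z ≫ (univCone Y g.1.right.obj k).leg
    (StructuredArrow.mk (Y := b.right) f.right.hom) hb) h1
  rw [toRMatching_leg, Category.assoc, toRMatching_leg] at h2
  exact h2.trans (c.leg_congr _ (StructuredArrow.w f) hb)

open Classical in
/-- The pointed cone in degrees at most `k` given by a pointed cone in degrees less than `k`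
and a compatible map to the product of the objects of degree `k`. -/
noncomputable def extend (hY : IsPointed Y) (c : PtCone Y s k X) (σ : X ⟶ eqProd Y s k)
    (h : σ ≫ structProd hY s k = c.rho) : PtCone Y s (k + 1) X where
  leg a ha :=
    if hk : deg a.right.obj < k then c.leg a hk
    -- Null morphisms do not index factors of `eqProd`, so this leg is not supplied by `σ`;
    -- pointedness forces it to be zero.
    else if hn : Null a.hom then 0
    else σ ≫ Pi.π (fun g : EqIdx P s k => Y.obj g.1.right)
      ⟨a, le_antisymm (Nat.le_of_lt_succ ha) (not_lt.1 hk), hn⟩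
  natural {a b} f ha hb := by
    have hle := deg_le_of_hom f.right.hom
    by_cases hka : deg a.right.obj < k
    · rw [dif_pos hka, dif_pos (hle.trans_lt hka)]
      exact c.natural f _ _
    · by_cases hkb : deg b.right.obj < k
      · rw [dif_neg hka, dif_pos hkb]
        by_cases hn : Null a.hom
        · rw [dif_pos hn, zero_comp]
          refine (c.leg_null b hkb ?_).symm
          have hw : a.hom ≫ f.right.hom = b.hom := StructuredArrow.w f
          rw [← hw]
          exact PointedIndexing.null_comp_left _ _ hn
        · rw [dif_neg hn]
          exact c.leg_eq_of_structProd hY σ h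
            ⟨a, le_antisymm (Nat.le_of_lt_succ ha) (not_lt.1 hka), hn⟩ f hkb
      -- Both targets have degree exactly `k`, so `f` is an identity.
      · obtain ⟨rfl, rfl⟩ := out_hom_eq_eqToHom f
          ((Nat.le_of_lt_succ ha).trans (not_lt.1 hkb))
        exact (congrArg (fun z => _ ≫ z) (Y.map_id _)).trans (Category.comp_id _)
  leg_null a ha hn := by
    by_cases hk : deg a.right.obj < k
    · rw [dif_pos hk, c.leg_null a hk hn]
    · rw [dif_neg hk, dif_pos hn]

lemma extend_restrict (hY : IsPointed Y) (c : PtCone Y s k X) (σ : X ⟶ eqProd Y s k)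
    (h : σ ≫ structProd hY s k = c.rho) :
    (c.extend hY σ h).restrict (Nat.le_succ k) = c :=
  ext_leg fun _ ha => dif_pos ha

lemma extend_top (hY : IsPointed Y) (c : PtCone Y s k X) (σ : X ⟶ eqProd Y s k)
    (h : σ ≫ structProd hY s k = c.rho) : (c.extend hY σ h).top = σ := by
  refine Pi.hom_ext _ _ fun g => ?_
  rw [top, Pi.lift_π]
  exact (dif_neg (by rw [g.2.1]; exact lt_irrefl k)).trans (dif_neg g.2.2)

lemma eq_of_restrict_of_top {c c' : PtCone Y s (k + 1) X}
    (h : c.restrict (Nat.le_succ k) = c'.restrict (Nat.le_succ k)) (h' : c.top = c'.top) :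
    c = c' := by
  refine ext_leg fun a ha => ?_
  by_cases hk : deg a.right.obj < k
  · exact congrFun (congrFun (congrArg leg h) a) hk
  · by_cases hn : Null a.hom
    · rw [c.leg_null a ha hn, c'.leg_null a ha hn]
    · have := congrArg (fun z => z ≫ Pi.π (fun g : EqIdx P s k => Y.obj g.1.right)
        ⟨a, le_antisymm (Nat.le_of_lt_succ ha) (not_lt.1 hk), hn⟩) h'
      simpa only [top, Pi.lift_π] using this

end PtCone

/-- The reduced matching objects are obtained inductively as pullbacks of the products of the
structure maps. -/
lemma isPullback_rMatching (hY : IsPointed Y) (s : J) (k : ℕ) :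
    IsPullback ((univCone Y s (k + 1)).restrict (Nat.le_succ k)).toRMatching
      (univCone Y s (k + 1)).top (univCone Y s k).rho (structProd hY s k) := by
  -- Commutativity of a square over `matchProd` is precisely the compatibility required to extend
  -- the cone classified by `t.fst` by the legs in `t.snd`.
  have hsnd (t : PullbackCone (univCone Y s k).rho (structProd hY s k)) :
      t.snd ≫ structProd hY s k = ((univCone Y s k).precomp t.fst).rho := by
    rw [← PtCone.comp_rho, t.condition]
  refine ⟨⟨?_⟩, ⟨PullbackCone.IsLimit.mk _
    (fun t => (((univCone Y s k).precomp t.fst).extend hY t.snd (hsnd t)).toRMatching)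
    (fun t => ?_) (fun t => ?_) (fun t z h1 h2 => ?_)⟩⟩
  · rw [PtCone.comp_rho, PtCone.univCone_precomp_toRMatching, PtCone.rho_eq_top_structProd hY]
  · refine PtCone.rMatching_hom_ext fun a ha => ?_
    rw [Category.assoc, PtCone.toRMatching_leg]
    refine (PtCone.toRMatching_leg _ a (ha.trans (Nat.lt_succ_self k))).trans ?_
    exact congrFun (congrFun (congrArg PtCone.leg
      (PtCone.extend_restrict hY ((univCone Y s k).precomp t.fst) t.snd (hsnd t))) a) ha
  · rw [PtCone.comp_top, PtCone.univCone_precomp_toRMatching, PtCone.extend_top]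
  · refine PtCone.toRMatching_unique _ _ fun a ha => ?_
    refine congrFun (congrFun (congrArg PtCone.leg
      (PtCone.eq_of_restrict_of_top (c := (univCone Y s (k + 1)).precomp z) ?_ ?_)) a) ha
    · rw [PtCone.extend_restrict, ← h1]
      refine PtCone.ext_leg fun a ha => ?_
      exact (congrArg (fun y => z ≫ y) (PtCone.toRMatching_leg
        ((univCone Y s (k + 1)).restrict (Nat.le_succ k)) a ha)).symm.trans
          (Category.assoc _ _ _).symm
    · rw [PtCone.extend_top, ← h2, PtCone.comp_top]

/-- A limit embeds in the product of its values. Base change and products preserve monomorphisms, so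
the map `β` will be mono as well. -/
instance mono_forgetFull (m : ℕ) : Mono (forgetFull Y s m) where
  right_cancellation f g h := limit.hom_ext fun a => by
    have := congrArg
      (fun z => z ≫ Pi.π (fun a : Comma P s m => Y.obj a.obj.right) a) h
    simp only [Category.assoc, forgetFull_π] at this
    exact this

instance mono_rForget (m : ℕ) : Mono (rForget Y s m) :=
  inferInstanceAs (Mono (pullback.fst _ _))

instance mono_forgetProd (k : ℕ) : Mono (forgetProd Y s k) :=
  inferInstanceAs (Mono (Limits.Pi.map fun g : EqIdx P s k => rForget Y g.1.right.obj k))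

end Cones

/-! ### Fibrancy, and admissibility of the inductive towers -/

section Fibrancy

variable {J : Type w} [SmallCategory J] [WeakLattice J] [PointedIndexing J]
variable {E : Type u} [Category.{v} E] [ModelCategory E] [HasZeroMorphisms E]
variable {P : ObjectProperty J} {Y : P.FullSubcategory ⥤ E}

lemma isFibrant_pi {I : Type w} [Finite I] (X : I → E) [∀ i, IsFibrant (X i)] :
    IsFibrant (∏ᶜ X) := by
  have : IsIso (terminal.from (∏ᶜ fun _ : I => ⊤_ E)) :=
    ⟨Pi.lift fun _ => 𝟙 _, Pi.hom_ext _ _ fun _ => Subsingleton.elim _ _,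
      Subsingleton.elim _ _⟩
  have : IsFibrant (∏ᶜ fun _ : I => ⊤_ E) := (isFibrant_iff _).2 inferInstance
  exact isFibrant_of_fibration (Limits.Pi.map fun i => terminal.from (X i))

/-- Being an isomorphism, the regrouping of factors can be composed with the lowest map of a tower
without destroying the fibration property. -/
lemma isIso_joinProd (s : J) (k : ℕ) : IsIso (joinProd Y s k) := by
  refine ⟨prod.lift (Pi.lift fun g => Pi.π (fun b : LowIdx P s (k + 1) => Y.obj b.1.right)
      ⟨g.1, g.2.1.trans_lt (Nat.lt_succ_self k), g.2.2⟩)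
    (Pi.lift fun g => Pi.π (fun b : LowIdx P s (k + 1) => Y.obj b.1.right)
      ⟨g.1, g.2.1.trans (Nat.lt_succ_self k), g.2.2⟩), ?_, ?_⟩
  · refine Limits.prod.hom_ext (Pi.hom_ext _ _ fun g => ?_) (Pi.hom_ext _ _ fun g => ?_)
    · rw [Category.assoc, Category.assoc, prod.lift_fst_assoc, Pi.lift_π, joinProd, Pi.lift_π,
        dif_pos g.2.1, Category.id_comp]
    · rw [Category.assoc, Category.assoc, prod.lift_snd_assoc, Pi.lift_π, joinProd, Pi.lift_π,
        dif_neg g.2.1.ne, Category.id_comp]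
  · refine Pi.hom_ext _ _ fun a => ?_
    rw [Category.assoc, joinProd, Pi.lift_π, Category.id_comp]
    split_ifs with h
    · rw [prod.lift_fst_assoc, Pi.lift_π]
    · rw [prod.lift_snd_assoc, Pi.lift_π]

lemma PointedReedyFibrant.fibration_structProd {hY : IsPointed Y} (h : PointedReedyFibrant hY)
    (s : J) (k : ℕ) : Fibration (structProd hY s k) := by
  have : ∀ g : EqIdx P s k, Fibration (structureMap hY g.1.right k) := by
    -- The target of `g` has degree exactly `k`, so the structure map in degrees `< k` is the one in
    -- the Reedy condition.
    rintro ⟨g, rfl, hg⟩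
    exact h g.right
  exact inferInstanceAs
    (Fibration (Limits.Pi.map fun g : EqIdx P s k => structureMap hY g.1.right k))

/-- No object has negative degree, so every object carries exactly one cone and the matching object
is terminal. -/
lemma isFibrant_rMatching_zero (s : J) : IsFibrant (rMatching Y s 0) := by
  let c : PtCone Y s 0 (⊤_ E) :=
    { leg := fun _ ha => absurd ha (Nat.not_lt_zero _)
      natural := fun _ ha => absurd ha (Nat.not_lt_zero _)
      leg_null := fun _ ha => absurd ha (Nat.not_lt_zero _) }
  have : IsIso (terminal.from (rMatching Y s 0)) :=
    ⟨c.toRMatching, PtCone.rMatching_hom_ext fun _ ha => absurd ha (Nat.not_lt_zero _),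
      Subsingleton.elim _ _⟩
  exact (isFibrant_iff _).2 inferInstance

/-- Passing from degrees `< k` to degrees `≤ k` is a base change of `structProd`, so the matching
objects form a tower of fibrations over a terminal object. -/
lemma PointedReedyFibrant.isFibrant_rMatching {hY : IsPointed Y} (h : PointedReedyFibrant hY)
    (s : J) (k : ℕ) : IsFibrant (rMatching Y s k) := by
  induction k with
  | zero => exact isFibrant_rMatching_zero s
  | succ k ih =>
    have : Fibration ((univCone Y s (k + 1)).restrict (Nat.le_succ k)).toRMatching :=
      (fibration_iff _).2 (MorphismProperty.of_isPullback (isPullback_rMatching hY s k).flip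
        ((fibration_iff _).1 (h.fibration_structProd s k)))
    exact isFibrant_of_fibration ((univCone Y s (k + 1)).restrict (Nat.le_succ k)).toRMatching

lemma PointedReedyFibrant.isFibrant_obj {hY : IsPointed Y} (h : PointedReedyFibrant hY)
    (t : P.FullSubcategory) : IsFibrant (Y.obj t) := by
  have := h t
  have := h.isFibrant_rMatching t.obj (deg t.obj)
  exact isFibrant_of_fibration (structureMap hY t (deg t.obj))

lemma PointedReedyFibrant.isFibrant_lowProd {hY : IsPointed Y} (h : PointedReedyFibrant hY)
    (s : J) (k : ℕ) : IsFibrant (lowProd Y s k) := by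
  have := fun a : LowIdx P s k => h.isFibrant_obj a.1.right
  exact isFibrant_pi _

/-- The starting tower has only a top map. Each inductive step adds fibrations produced by
factorizations and pulls back those already present, so pointedness of the diagram suffices. -/
lemma sepTower_fibrationsBelowTop (hY : IsPointed Y) (χ : GridChoices J E) (n : ℕ) (s : J) :
    (sepTower hY χ n s).1.FibrationsBelowTop := by
  induction n generalizing s with
  | zero => trivial
  | succ n ih =>
    have := isIso_joinProd (Y := Y) s (n + 2)
    have : Fibration (firstStep hY s (n + 2)
        (Tower.pi fun g : EqIdx P s (n + 2) => (sepTower hY χ n g.1.right.obj).1)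
        (sepColumn_comp hY χ s n) (χ.diag s (n + 2) (genDiag Y s (n + 2)))).q :=
      (fibration_iff _).2 (χ.diag s (n + 2) (genDiag Y s (n + 2))).hp
    refine Tower.FibrationsBelowTop.postcomp (Tower.FibrationsBelowTop.precomp
      (Tower.FibrationsBelowTop.prod ?_ ?_) _) (joinProd Y s (n + 2))
    · exact Column.topRow_fibrationsBelowTop _ _ _ _ _ _
    · exact ((Tower.FibrationsBelowTop.pi fun g => ih g.1.right.obj).pull _).capFac _ _

lemma isSeparating_sepColumn {hY : IsPointed Y} (h : PointedReedyFibrant hY)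
    (χ : GridChoices J E) (x : J) (m : ℕ) :
    IsSeparating hY x (m + 2) (sepColumn hY χ x m) where
  comp_eq := sepColumn_comp hY χ x m
  fibration_cap := h.fibration_structProd x (m + 2)
  fibrations := Tower.FibrationsBelowTop.pi fun g =>
    sepTower_fibrationsBelowTop hY χ m g.1.right.obj
  -- The top map is the first factor of the monomorphism `β`.
  mono := Tower.monoTop_of_mono_comp _ (by rw [sepColumn_comp]; infer_instance)
  fibrant_mid := by
    have := fun g : EqIdx P x (m + 2) => h.isFibrant_rMatching g.1.right.obj (m + 2)
    exact isFibrant_pi _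
  fibrant_base := by
    have := fun g : EqIdx P x (m + 2) => h.isFibrant_lowProd g.1.right.obj (m + 2)
    exact isFibrant_pi _

end Fibrancy

/-! ### From a pointed cone to a diagram on `J_x^k` -/

section ConeFunctor

variable {J : Type w} [SmallCategory J] [WeakLattice J]

lemma bdry_of_hom {x : J} {k : ℕ} {a b : J} (f : a ⟶ b) (h : bdry x k a) : bdry x k b :=
  ⟨h.1.map fun p => p ≫ f, (deg_le_of_hom f).trans h.2⟩

variable {x : J} {k : ℕ}

/-- A morphism from `x` to an object of `∂J_x^k`, as an object of the comma category. -/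
abbrev outTo {b : J} (h : bdry x k b) (u : x ⟶ b) : Out (bdry x k) x :=
  let t : (bdry x k).FullSubcategory := ⟨b, h⟩
  StructuredArrow.mk (T := (bdry x k).ι) (Y := t) u

lemma eq_vertex_of_not_bdry (a : (under x k).FullSubcategory) (h : ¬ bdry x k a.obj) :
    a.obj = x :=
  a.property.resolve_right h

lemma hom_eq_eqToHom {a b : J} (f : a ⟶ b) (h : a = b) : f = eqToHom h := by
  rcases WeakLattice.id_or_deg_lt f with ⟨_, hf⟩ | hlt
  · exact hf
  · exact absurd hlt (by rw [h]; exact lt_irrefl _)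

variable [PointedIndexing J] {E : Type u} [Category.{v} E] [HasZeroMorphisms E]
variable {Y : (bdry x k).FullSubcategory ⥤ E} {X : E}

variable (Y X) in
/-- The values of the diagram on `J_x^k` given by a diagram on `∂J_x^k` and a pointed cone. -/
def coneObj (a : (under x k).FullSubcategory) : Decidable (bdry x k a.obj) → E
  -- Membership in `∂J_x^k` is decided by an argument, so that in each case the value reduces
  -- definitionally; later proofs quantify over this argument and split it.
  | isTrue h => Y.obj ⟨a.obj, h⟩
  | isFalse _ => X

/-- The maps of the diagram on `J_x^k` given by a diagram on `∂J_x^k` and a pointed cone. -/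
def coneMap (c : PtCone Y x (k + 1) X) {a b : (under x k).FullSubcategory} (f : a ⟶ b) :
    ∀ (da : Decidable (bdry x k a.obj)) (db : Decidable (bdry x k b.obj)),
      coneObj Y X a da ⟶ coneObj Y X b db
  | isTrue ha, isTrue hb =>
      Y.map (X := ⟨a.obj, ha⟩) (Y := ⟨b.obj, hb⟩) (ObjectProperty.homMk f.hom)
  | isFalse ha, isTrue hb =>
      c.leg (outTo hb (eqToHom (eq_vertex_of_not_bdry a ha).symm ≫ f.hom)) (Nat.lt_succ_of_le hb.2)
  | isFalse _, isFalse _ => 𝟙 X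
  | isTrue _, isFalse _ => 0

lemma coneMap_id (c : PtCone Y x (k + 1) X) (a : (under x k).FullSubcategory)
    (da : Decidable (bdry x k a.obj)) : coneMap c (𝟙 a) da da = 𝟙 _ := by
  cases da with
  | isTrue h => exact Y.map_id _
  | isFalse h => rfl

lemma coneMap_comp (c : PtCone Y x (k + 1) X) {a b d : (under x k).FullSubcategory}
    (f : a ⟶ b) (g : b ⟶ d) (da : Decidable (bdry x k a.obj)) (db : Decidable (bdry x k b.obj))
    (dd : Decidable (bdry x k d.obj)) :
    coneMap c (f ≫ g) da dd = coneMap c f da db ≫ coneMap c g db dd := by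
  match da, db, dd with
  | isTrue ha, isTrue hb, isTrue hd =>
    exact Y.map_comp (X := ⟨a.obj, ha⟩) (Y := ⟨b.obj, hb⟩)
      (Z := ⟨d.obj, hd⟩) (ObjectProperty.homMk f.hom) (ObjectProperty.homMk g.hom)
  | isTrue ha, isFalse hb, _ => exact absurd (bdry_of_hom f.hom ha) hb
  | isTrue ha, _, isFalse hd => exact absurd (bdry_of_hom (f ≫ g).hom ha) hd
  | isFalse ha, isTrue hb, isFalse hd => exact absurd (bdry_of_hom g.hom hb) hd
  | isFalse ha, isTrue hb, isTrue hd =>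
    exact (c.natural (a := outTo hb (eqToHom (eq_vertex_of_not_bdry a ha).symm ≫ f.hom))
      (b := outTo hd (eqToHom (eq_vertex_of_not_bdry a ha).symm ≫ (f ≫ g).hom))
      (StructuredArrow.homMk (ObjectProperty.homMk g.hom)
      (Category.assoc _ _ _)) _ _).symm
  | isFalse ha, isFalse hb, isTrue hd =>
    refine Eq.trans ?_ (Category.id_comp _).symm
    refine c.leg_congr (a := outTo hd (eqToHom (eq_vertex_of_not_bdry b hb).symm ≫ g.hom)) _ ?_ _
    change _ ≫ f.hom ≫ g.hom = _ ≫ g.hom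
    rw [hom_eq_eqToHom f.hom
      ((eq_vertex_of_not_bdry a ha).trans (eq_vertex_of_not_bdry b hb).symm),
      eqToHom_trans_assoc]
  | isFalse ha, isFalse hb, isFalse hd => exact (Category.id_comp _).symm

open Classical in
/-- The diagram on `J_x^k` given by a diagram on `∂J_x^k` and a pointed cone. -/
noncomputable def coneFunctor (c : PtCone Y x (k + 1) X) : (under x k).FullSubcategory ⥤ E where
  obj a := coneObj Y X a inferInstance
  map f := coneMap c f _ _
  map_id a := coneMap_id c a _
  map_comp f g := coneMap_comp c f g _ _ _

/-- The cone accounts for null morphisms out of `x` into `∂J_x^k`. The condition `hX` is for the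
remaining case, where `x` is itself a zero object and its identity must go to zero. -/
lemma coneFunctor_isPointed (hY : IsPointed Y) (c : PtCone Y x (k + 1) X)
    (hX : Null (𝟙 x) → 𝟙 X = 0) : IsPointed (coneFunctor c) := by
  intro a b f hf
  have key : ∀ da db, coneMap c f da db = 0 := by
    intro da db
    match da, db with
    | isTrue ha, isTrue hb => exact hY _ hf
    | isFalse ha, isTrue hb =>
      exact c.leg_null (outTo hb _) _ (PointedIndexing.null_comp_right _ _ hf)
    | isTrue ha, isFalse hb => rfl
    | isFalse ha, isFalse hb =>
      refine hX ?_
      have h1 := PointedIndexing.null_comp_right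
        (eqToHom (eq_vertex_of_not_bdry a ha).symm) f.hom hf
      have h2 := PointedIndexing.null_comp_left _ (eqToHom (eq_vertex_of_not_bdry b hb)) h1
      -- An endomorphism of `x` is the identity, so nullity of `f` makes the identity of `x` null.
      rwa [hom_eq_eqToHom (_ ≫ _) rfl] at h2
  exact key _ _

lemma ιOfLE_comp_coneFunctor (c : PtCone Y x (k + 1) X) :
    ObjectProperty.ιOfLE (bdry_le_under x k) ⋙ coneFunctor c = Y := by
  refine Functor.hext (fun a => ?_) (fun a b f => ?_)
  · have key : ∀ da, coneObj Y X ((ObjectProperty.ιOfLE (bdry_le_under x k)).obj a) da =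
        Y.obj a := by
      rintro (h | h)
      · exact absurd a.property h
      · rfl
    exact key _
  · have key : ∀ da db, HEq (coneMap c ((ObjectProperty.ιOfLE (bdry_le_under x k)).map f) da db)
        (Y.map f) := by
      rintro (h | h) (h' | h')
      · exact absurd a.property h
      · exact absurd a.property h
      · exact absurd b.property h'
      · rfl
    exact key _ _

end ConeFunctor

/-! ### Homotopies into products, and zero maps in the homotopy category -/

section Homotopies

variable {E : Type u} [Category.{v} E] [ModelCategory E]

/-- With cofibrant source and fibrant targets, all the homotopies can be realised on one common
cylinder, where they assemble into a homotopy into the product. -/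
lemma leftHomotopyRel_piLift {I : Type w} [Finite I] {X : E} [IsCofibrant X] {Z : I → E}
    [∀ i, IsFibrant (Z i)] {f g : ∀ i, X ⟶ Z i} (h : ∀ i, LeftHomotopyRel (f i) (g i)) :
    LeftHomotopyRel (Pi.lift f) (Pi.lift g) := by
  obtain ⟨P, _⟩ := Cylinder.exists_very_good X
  let H := fun i => (h i).leftHomotopy P
  exact ⟨P, ⟨{
    h := Pi.lift fun i => (H i).h
    h₀ := Pi.hom_ext _ _ fun i => by
      rw [Category.assoc, Pi.lift_π, Pi.lift_π]
      exact (H i).h₀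
    h₁ := Pi.hom_ext _ _ fun i => by
      rw [Category.assoc, Pi.lift_π, Pi.lift_π]
      exact (H i).h₁ }⟩⟩

variable {H : Type u'} [Category.{v'} H] (L : E ⥤ H) [L.IsLocalization (weakEquivalences E)]

open ZeroObject in
/-- The localization functor sends zero maps out of cofibrant objects to zero maps. -/
lemma map_zero_eq_of_isZero [HasZeroObject E] [HasZeroMorphisms E] {X Y : E} [IsCofibrant X]
    {Z : H} (hZ : IsZero Z) (u : L.obj X ⟶ Z) (v : Z ⟶ L.obj Y) :
    L.map (0 : X ⟶ Y) = u ≫ v := by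
  have : IsIso (terminal.from (0 : E)) :=
    ⟨0, (isZero_zero E).eq_of_src _ _, Subsingleton.elim _ _⟩
  have : IsFibrant (0 : E) := (isFibrant_iff _).2 inferInstance
  -- The composite through `Z` is represented by some `f : X ⟶ 0`, as `0` is fibrant. Hence `L.map
  -- 0` factors through `Z`, without first showing that `L` preserves zero objects; uniqueness of
  -- maps out of `Z` then identifies the second factor with `v`.
  obtain ⟨f, hf⟩ := map_surjective_of_isLocalization L X (0 : E) (u ≫ hZ.to_ _)
  have h : (0 : X ⟶ Y) = f ≫ (0 : (0 : E) ⟶ Y) := comp_zero.symm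
  rw [h, L.map_comp, hf, Category.assoc]
  congr 1
  exact hZ.eq_of_src _ _

end Homotopies

/-! ### The extension problem and the two kinds of vanishing -/

section Extension

variable {J : Type w} [SmallCategory J] [WeakLattice J] [PointedIndexing J]
variable {E : Type u} [Category.{v} E] [ModelCategory E] [HasZeroMorphisms E]
variable {H : Type u'} [Category.{v'} H] {L : E ⥤ H} {x : J} {m : ℕ} {S : ExtensionData L x m}

namespace ExtensionData

/-- The projection from `F^2` to `M` transports homotopies one way, and as a base change of `F.p` it
lifts them the other way. -/
lemma totalVanishes_iff (ρ : S.Representatives) (F : S.DiagFactorization) :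
    TotalVanishes ρ F ↔
      LeftHomotopyRel (ρ.sigma ≫ structProd S.pointed_Yk x (m + 2)) S.cone.rho := by
  have := S.cofibrant
  have : Fibration F.p := (fibration_iff _).2 F.hp
  have hsnd : (S.cone.eta ≫ gamma F) ≫ pullback.snd F.p (forgetProd S.Yk x (m + 2)) =
      S.cone.rho := by
    rw [Category.assoc, gamma, pullback.lift_snd, PtCone.eta_snd]
  constructor
  · rintro ⟨θ, e, h, -⟩
    have e' := ((LeftHomotopyClass.mk_eq_mk_iff _ _).1 e).postcomp
      (pullback.snd F.p (forgetProd S.Yk x (m + 2)))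
    rw [hsnd] at e'
    -- The defining equation of the operation lives in `B`; cancelling the monomorphism `β`
    -- identifies the component of `θ` in `M`.
    have hθ : θ ≫ pullback.snd F.p (forgetProd S.Yk x (m + 2)) =
        ρ.sigma ≫ structProd S.pointed_Yk x (m + 2) := by
      rw [← cancel_mono (forgetProd S.Yk x (m + 2)), ← h, Category.assoc, Category.assoc,
        pullback.condition]
    rw [hθ] at e'
    exact e'.symm
  · intro h
    obtain ⟨θ, hθ, hh⟩ := exists_lift_of_leftHomotopyRel
      (pullback.snd F.p (forgetProd S.Yk x (m + 2))) h.symm (S.cone.eta ≫ gamma F) hsnd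
    refine ⟨θ, LeftHomotopyClass.sound hh, ?_, ?_⟩
    · rw [← hθ, Category.assoc, Category.assoc, pullback.condition]
    · have h1 : (S.cone.eta ≫ gamma F) ≫ pullback.fst F.p (forgetProd S.Yk x (m + 2)) =
          S.cone.toLow ≫ F.i := by
        rw [Category.assoc, gamma, pullback.lift_fst, ← Category.assoc, PtCone.eta_fst]
      exact h1 ▸ (hh.postcomp (pullback.fst F.p (forgetProd S.Yk x (m + 2)))).symm

/-- An extended cone is a second choice of representatives that is strictly compatible with the
lower legs. Equality after `L` is left homotopy here, since source and targets are cofibrant and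
fibrant; conversely, covering homotopy along the fibration `α` rectifies `σ`. -/
lemma exists_cone_iff [L.IsLocalization (weakEquivalences E)] (ρ : S.Representatives) :
    (∃ c : PtCone S.Yk x (m + 3) S.X, c.restrict (Nat.le_succ (m + 2)) = S.cone ∧
      ∀ g : EqIdx (bdry x (m + 2)) x (m + 2),
        L.map (c.leg g.1 (g.2.1.trans_lt (Nat.lt_succ_self _))) = L.map (ρ.map g)) ↔
      LeftHomotopyRel (ρ.sigma ≫ structProd S.pointed_Yk x (m + 2)) S.cone.rho := by
  have := S.cofibrant
  have := fun g : EqIdx (bdry x (m + 2)) x (m + 2) => S.reedyFibrant.isFibrant_obj g.1.right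
  constructor
  · rintro ⟨c, hc, h⟩
    have h1 : LeftHomotopyRel ρ.sigma c.top :=
      leftHomotopyRel_piLift fun g => (LeftHomotopyRel.iff_map_eq L _ _).2 (h g).symm
    have h2 := h1.postcomp (structProd S.pointed_Yk x (m + 2))
    rwa [← PtCone.rho_eq_top_structProd, hc] at h2
  · intro h
    have := S.reedyFibrant.fibration_structProd x (m + 2)
    obtain ⟨σ, hσ, hh⟩ := exists_lift_of_leftHomotopyRel
      (structProd S.pointed_Yk x (m + 2)) h ρ.sigma rfl
    refine ⟨S.cone.extend S.pointed_Yk σ hσ, PtCone.extend_restrict _ _ _ _, fun g => ?_⟩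
    have h1 := congrArg (fun z => z ≫ Pi.π (fun g : EqIdx _ x (m + 2) => S.Yk.obj g.1.right) g)
      (PtCone.extend_top S.pointed_Yk S.cone σ hσ)
    rw [PtCone.top, Pi.lift_π] at h1
    have h2 := hh.postcomp (Pi.π (fun g : EqIdx _ x (m + 2) => S.Yk.obj g.1.right) g)
    rw [Representatives.sigma, Pi.lift_π] at h2
    rw [h1]
    exact ((LeftHomotopyRel.iff_map_eq L _ _).1 h2).symm

lemma exists_cone_of_hasExtension (ρ : S.Representatives) (h : S.HasExtension) :
    ∃ c : PtCone S.Yk x (m + 3) S.X, c.restrict (Nat.le_succ (m + 2)) = S.cone ∧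
      ∀ g : EqIdx (bdry x (m + 2)) x (m + 2),
        L.map (c.leg g.1 (g.2.1.trans_lt (Nat.lt_succ_self _))) = L.map (ρ.map g) := by
  obtain ⟨Yho, Yx, Yk, hYho, hYx, hYk, agree, lift_Yx, lift_Yk, fib, cof⟩ := S
  obtain ⟨Y, hY, h1, h2, h3⟩ := h
  dsimp only at h1 h2 h3
  -- All given diagrams become restrictions of `Y`, so the comparison isomorphisms become identities
  -- definitionally.
  subst h1 h2 h3
  refine ⟨{
    leg := fun a _ => Y.map (X := vertex x (m + 2)) (Y := ⟨a.right.obj, Or.inr a.right.property⟩)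
      (ObjectProperty.homMk a.hom)
    natural := fun {a b} f _ _ => ?_
    leg_null := fun a _ hn => hY _ hn }, ?_, fun g => ?_⟩
  · refine (Y.map_comp (X := vertex x (m + 2)) (Y := ⟨a.right.obj, Or.inr a.right.property⟩)
      (Z := ⟨b.right.obj, Or.inr b.right.property⟩) (ObjectProperty.homMk a.hom)
      (ObjectProperty.homMk f.right.hom)).symm.trans ?_
    congr 1
    ext
    exact StructuredArrow.w f
  · refine PtCone.ext_leg fun a ha => ?_
    exact (Category.comp_id _).symm
  · refine Eq.trans ?_ (ρ.lift g).symm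
    exact (Category.id_comp _).symm.trans (congrArg (fun z => 𝟙 _ ≫ z) (Category.comp_id _).symm)

lemma null_vertex (S : ExtensionData L x m) (h : Null (𝟙 x)) : 𝟙 S.X = 0 :=
  (S.Yx.map_id (vertex x (m + 1))).symm.trans (S.pointed_Yx (𝟙 (vertex x (m + 1))) h)

lemma not_bdry_vertex (hx : m + 2 < deg x) : ¬ bdry x (m + 2) x := fun h =>
  absurd h.2 (not_le.2 hx)

lemma leg_heq (a : Out (bdry x (m + 2)) x) (ha : deg a.right.obj < m + 2) :
    HEq (S.leg a ha) (S.Yx.map (X := vertex x (m + 1))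
      (Y := ⟨a.right.obj, Or.inr (bdry_of_lt a ha)⟩) (ObjectProperty.homMk a.hom)) :=
  comp_eqToHom_heq _ _

/-- The assumption on `deg x` keeps `x` out of `∂J_x^k`, so the vertex keeps its own value. Equality
of functors is checked with `HEq`, to avoid carrying the identifications of objects. -/
lemma coneFunctor_restrict (hx : m + 2 < deg x) (c : PtCone S.Yk x (m + 3) S.X)
    (hc : c.restrict (Nat.le_succ (m + 2)) = S.cone) :
    ObjectProperty.ιOfLE (under_mono x (Nat.le_succ (m + 1))) ⋙ coneFunctor c = S.Yx := by
  have hb (a : (under x (m + 1)).FullSubcategory) (h : bdry x (m + 2) a.obj) :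
      bdry x (m + 1) a.obj :=
    a.property.resolve_left fun e => not_bdry_vertex hx (by rwa [e] at h)
  refine Functor.hext (fun a => ?_) (fun a b f => ?_)
  · have key : ∀ da, coneObj S.Yk S.X
        ((ObjectProperty.ιOfLE (under_mono x (Nat.le_succ (m + 1)))).obj a) da = S.Yx.obj a := by
      rintro (h | h)
      · obtain ⟨a, ha⟩ := a
        obtain rfl : a = x := eq_vertex_of_not_bdry _ h
        rfl
      · exact (S.obj_eq a.obj (hb a h)).symm
    exact key _
  · have key : ∀ da db, HEq (coneMap c
        ((ObjectProperty.ιOfLE (under_mono x (Nat.le_succ (m + 1)))).map f) da db)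
        (S.Yx.map f) := by
      rintro (h | h) (h' | h')
      · obtain ⟨a, ha⟩ := a
        obtain ⟨b, hb⟩ := b
        obtain rfl : a = x := eq_vertex_of_not_bdry _ h
        obtain rfl : b = a := eq_vertex_of_not_bdry _ h'
        have : f = 𝟙 _ := by
          ext
          exact hom_eq_eqToHom f.hom rfl
        rw [this]
        exact heq_of_eq (S.Yx.map_id _).symm
      · obtain ⟨a, ha⟩ := a
        obtain rfl : a = x := eq_vertex_of_not_bdry _ h
        let g : Out (bdry a (m + 2)) a := outTo h' f.hom
        have hg : deg g.right.obj < m + 2 := Nat.lt_succ_of_le (hb b h').2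
        have h1 : c.leg g (hg.trans (Nat.lt_succ_self _)) = S.leg g hg :=
          congrFun (congrFun (congrArg PtCone.leg hc) g) hg
        have h2 := c.leg_congr (a := g) (eqToHom rfl ≫ f.hom) (Category.id_comp _)
          (hg.trans (Nat.lt_succ_self _))
        exact (heq_of_eq (h2.trans h1)).trans (leg_heq g hg)
      · exact absurd (bdry_of_hom f.hom h) h'
      · exact Functor.hcongr_hom S.agree (X := ⟨a.obj, hb a h⟩) (Y := ⟨b.obj, hb b h'⟩)
          (ObjectProperty.homMk f.hom)
    exact key _ _

/-- Each kind of leg has its own source of agreement: in degrees `< k` the strict diagram lifts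
`Yho`; for null morphisms to degree `k` both sides are zero maps, by `map_zero_eq_of_isZero`; for
the others the leg is homotopic to a chosen representative. -/
lemma map_leg_heq [HasZeroObject E] [L.IsLocalization (weakEquivalences E)]
    (ρ : S.Representatives) (c : PtCone S.Yk x (m + 3) S.X)
    (hc : c.restrict (Nat.le_succ (m + 2)) = S.cone)
    (h : ∀ g : EqIdx (bdry x (m + 2)) x (m + 2),
      L.map (c.leg g.1 (g.2.1.trans_lt (Nat.lt_succ_self _))) = L.map (ρ.map g))
    (a : Out (bdry x (m + 2)) x) (ha : deg a.right.obj < m + 3) :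
    HEq (L.map (c.leg a ha)) (S.Yho.map (X := vertex x (m + 2))
      (Y := ⟨a.right.obj, Or.inr a.right.property⟩) (ObjectProperty.homMk a.hom)) := by
  have := S.cofibrant
  have eX : L.obj S.X = S.Yho.obj (vertex x (m + 2)) :=
    Functor.congr_obj S.lift_Yx (vertex x (m + 1))
  have eY : L.obj (S.Yk.obj a.right) = S.Yho.obj ⟨a.right.obj, Or.inr a.right.property⟩ :=
    Functor.congr_obj S.lift_Yk a.right
  by_cases hk : deg a.right.obj < m + 2
  · have h1 : c.leg a ha = S.leg a hk := congrFun (congrFun (congrArg PtCone.leg hc) a) hk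
    have h2 := Functor.hcongr_hom S.lift_Yx (X := vertex x (m + 1))
      (Y := ⟨a.right.obj, Or.inr (bdry_of_lt a hk)⟩) (ObjectProperty.homMk a.hom)
    refine HEq.trans ?_ h2
    rw [h1, leg, L.map_comp, compare, eqToHom_map]
    exact comp_eqToHom_heq _ _
  · by_cases hn : Null a.hom
    · obtain ⟨Z, hZ, p, q, e⟩ := S.pointed_Yho (a := vertex x (m + 2))
        (b := ⟨a.right.obj, Or.inr a.right.property⟩) (ObjectProperty.homMk a.hom) hn
      rw [c.leg_null a ha hn, e,
        map_zero_eq_of_isZero L hZ (eqToHom eX ≫ p) (q ≫ eqToHom eY.symm)]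
      simp only [Category.assoc]
      refine (eqToHom_comp_heq _ _).trans ?_
      rw [← Category.assoc]
      exact comp_eqToHom_heq _ _
    · have h1 := h ⟨a, le_antisymm (Nat.le_of_lt_succ ha) (not_lt.1 hk), hn⟩
      rw [ρ.lift] at h1
      rw [h1]
      refine (eqToHom_comp_heq _ _).trans ?_
      exact comp_eqToHom_heq _ _

lemma coneFunctor_comp [HasZeroObject E] [L.IsLocalization (weakEquivalences E)]
    (ρ : S.Representatives) (c : PtCone S.Yk x (m + 3) S.X)
    (hc : c.restrict (Nat.le_succ (m + 2)) = S.cone)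
    (h : ∀ g : EqIdx (bdry x (m + 2)) x (m + 2),
      L.map (c.leg g.1 (g.2.1.trans_lt (Nat.lt_succ_self _))) = L.map (ρ.map g)) :
    coneFunctor c ⋙ L = S.Yho := by
  refine Functor.hext (fun a => ?_) (fun a b f => ?_)
  · have key : ∀ da, L.obj (coneObj S.Yk S.X a da) = S.Yho.obj a := by
      rintro (h | h)
      · obtain ⟨a, ha⟩ := a
        obtain rfl : a = x := eq_vertex_of_not_bdry _ h
        exact Functor.congr_obj S.lift_Yx (vertex a (m + 1))
      · exact Functor.congr_obj S.lift_Yk ⟨a.obj, h⟩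
    exact key _
  · have key : ∀ da db, HEq (L.map (coneMap c f da db)) (S.Yho.map f) := by
      rintro (ha | ha) (hb | hb)
      · obtain ⟨a, ha'⟩ := a
        obtain ⟨b, hb'⟩ := b
        obtain rfl : a = x := eq_vertex_of_not_bdry _ ha
        obtain rfl : b = a := eq_vertex_of_not_bdry _ hb
        have : f = 𝟙 _ := by
          ext
          exact hom_eq_eqToHom f.hom rfl
        rw [this]
        have h1 := Functor.hcongr_hom S.lift_Yx (𝟙 (vertex b (m + 1)))
        rw [CategoryTheory.Functor.map_id] at h1
        refine HEq.trans (heq_of_eq (L.map_id S.X)) (h1.trans ?_)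
        rfl
      · obtain ⟨a, ha'⟩ := a
        obtain rfl : a = x := eq_vertex_of_not_bdry _ ha
        have h1 := map_leg_heq ρ c hc h (outTo hb f.hom)
          (Nat.lt_succ_of_le hb.2)
        have h2 := c.leg_congr (a := outTo hb f.hom)
          (eqToHom rfl ≫ f.hom) (Category.id_comp _) (Nat.lt_succ_of_le hb.2)
        exact (heq_of_eq (congrArg L.map h2)).trans h1
      · exact absurd (bdry_of_hom f.hom ha) hb
      · exact Functor.hcongr_hom S.lift_Yk (X := ⟨a.obj, ha⟩) (Y := ⟨b.obj, hb⟩)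
          (ObjectProperty.homMk f.hom)
    exact key _ _

/-- A further extension exists if and only if the map given by representatives in degree `k` is
compatible, up to homotopy, with the strict diagram on `J_x^{k-1}`. -/
theorem hasExtension_iff [HasZeroObject E] [L.IsLocalization (weakEquivalences E)]
    (hx : m + 2 < deg x) (ρ : S.Representatives) :
    S.HasExtension ↔
      LeftHomotopyRel (ρ.sigma ≫ structProd S.pointed_Yk x (m + 2)) S.cone.rho := by
  refine ⟨fun h => (exists_cone_iff ρ).1 (exists_cone_of_hasExtension ρ h), fun h => ?_⟩
  obtain ⟨c, hc, hL⟩ := (exists_cone_iff ρ).2 h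
  exact ⟨coneFunctor c, coneFunctor_isPointed S.pointed_Yk c S.null_vertex,
    ιOfLE_comp_coneFunctor c, coneFunctor_restrict hx c hc, coneFunctor_comp ρ c hc hL⟩

lemma separatedVanish_iff (ρ : S.Representatives) (F : S.DiagFactorization)
    (R : Tower m (matchProd S.Yk x (m + 2)) (doubleProd S.Yk x (m + 2)))
    (hR : IsSeparating S.pointed_Yk x (m + 2) R) (φ : ℕ → Factorizations E) :
    SeparatedVanish ρ F R hR.comp_eq φ ↔
      LeftHomotopyRel (ρ.sigma ≫ structProd S.pointed_Yk x (m + 2)) S.cone.rho := by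
  have := S.cofibrant
  have : Fibration (firstStep S.pointed_Yk x (m + 2) R hR.comp_eq F).q :=
    (fibration_iff _).2 F.hp
  refine (Column.vanishInTurn_iff φ (rightColumn S.pointed_Yk x (m + 2) R)
    (firstStep S.pointed_Yk x (m + 2) R hR.comp_eq F) hR.mono S.cone.eta ρ.sigma).trans ?_
  rw [← PtCone.eta_snd]
  rfl

end ExtensionData

end Extension

end HigherOp

/-! ### The main theorem -/

theorem mainTheorem2 {J : Type w} [SmallCategory J] [HigherOp.WeakLattice J]
    [HigherOp.PointedIndexing J]
    {E : Type u} [Category.{v} E] [ModelCategory E] [HasZeroObject E] [HasZeroMorphisms E]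
    {H : Type u'} [Category.{v'} H] (L : E ⥤ H) [L.IsLocalization (weakEquivalences E)]
    (m : ℕ) (x : J) (hx : m + 2 < HigherOp.deg x)
    (S : HigherOp.ExtensionData L x m) (ρ : S.Representatives) (F : S.DiagFactorization) :
    (∀ χ : HigherOp.GridChoices J E, HigherOp.IsSeparating S.pointed_Yk x (m + 2)
      (HigherOp.sepColumn S.pointed_Yk χ x m)) ∧
    ∀ (R : HigherOp.Tower m (HigherOp.matchProd S.Yk x (m + 2))
        (HigherOp.doubleProd S.Yk x (m + 2)))
      (hR : HigherOp.IsSeparating S.pointed_Yk x (m + 2) R),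
      (∃ e : R.pullTop F.p ≅ pullback F.p (HigherOp.forgetProd S.Yk x (m + 2)),
        e.hom ≫ pullback.fst _ _ = (R.pull F.p).comp ∧
        e.hom ≫ pullback.snd _ _ = R.pullProj F.p) ∧
      ∀ φ : ℕ → HigherOp.Factorizations E,
        List.TFAE
          [S.HasExtension,
            HigherOp.ExtensionData.TotalVanishes ρ F,
            HigherOp.ExtensionData.SeparatedVanish ρ F R hR.comp_eq φ] := by
  refine ⟨fun χ => HigherOp.isSeparating_sepColumn S.reedyFibrant χ x m, fun R hR => ⟨?_, ?_⟩⟩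
  -- The second object from the top of column `1` is the pullback along the composite of the whole
  -- tower, and that composite is `β`.
  · have h := R.isPullback_pull F.p
    rw [hR.comp_eq] at h
    exact ⟨h.isoPullback, h.isoPullback_hom_fst, h.isoPullback_hom_snd⟩
  · intro φ
    tfae_have 1 ↔ 2 := (HigherOp.ExtensionData.hasExtension_iff hx ρ).trans
      (HigherOp.ExtensionData.totalVanishes_iff ρ F).symm
    tfae_have 2 ↔ 3 := (HigherOp.ExtensionData.totalVanishes_iff ρ F).trans
      (HigherOp.ExtensionData.separatedVanish_iff ρ F R hR φ).symm
    tfae_finish
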